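/- **Setting.** Let $d\ge 1$ and let $\Lambda_1\subset\Lambda_2\subset\cdots$ be finite subsets of $\mathbb Z^d$ with $\bigcup_n\Lambda_n=\mathbb Z^d$. Consider spin-$\tfrac12$ lattice fermions with creation and annihilation operators $c^\dagger_{x,\sigma},c_{x,\sigma}$ and $n_{x,\sigma}=c^\dagger_{x,\sigma}c_{x,\sigma}$, $\sigma\in\{\uparrow,\downarrow\}$. A $U(1)$ gauge field $A$ assigns to every oriented nearest-neighbour pair a value $A_{x,y}\in\mathbb R \bmod 2\pi$ with $A_{y,x}=-A_{x,y}$. For a finite $\Lambda\subset\mathbb Z^d$ put $$\tilde H_\Lambda(A)=\sum_{x,y\in\Lambda}\sum_{\alpha,\beta'}t^{\alpha,\beta'}_{x,y}e^{iA_{x,y}}c^\dagger_{x,\alpha}c_{y,\beta'}+\sum_{I\ge1}\sum_{x_1,\sigma_1}\cdots\sum_{x_I,\sigma_I}W_{x_1,\sigma_1;\ldots;x_I,\sigma_I}\,n_{x_1,\sigma_1}\cdots n_{x_I,\sigma_I},$$ where the sites $x_i$ run over $\Lambda$. The hopping amplitudes are uniformly bounded, satisfy $t_{y,x}^{\beta',\alpha}=\overline{t_{x,y}^{\alpha,\beta'}}$,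 and vanish unless $x,y$ are nearest neighbours; the couplings $W$ are real, uniformly bounded, of finite range, and nonzero only for finitely many orders $I$. Let each site $x\in\mathbb Z^d$ have a neighbourhood $\mathcal N_x\subset\mathbb Z^d$ contained in a ball about $x$ whose radius does not depend on $x$, and let $$H_{\mathrm{ext},\Lambda}=\sum_{x\in\Lambda}\ \sum_{y\in\mathcal N_x\cap\Lambda}\bigl(c_{x,\uparrow}c_{y,\downarrow}+c^\dagger_{y,\downarrow}c^\dagger_{x,\uparrow}\bigr),\qquad \mathcal M_\Lambda=\frac1{|\Lambda|}H_{\mathrm{ext},\Lambda}.$$ With $\mu\in\mathbb R$ and $N_\Lambda=\sum_{x\in\Lambda}\sum_\sigma n_{x,\sigma}$, denote by $\langle\,\cdot\,\rangle_\Lambda(\beta,h,A)$ the thermal expectation at inverse temperature $\beta>0$ for the Hamiltonian $\tilde H_\Lambda(A)-\mu N_\Lambda-hH_{\mathrm{ext},\Lambda}$. Define, every limit over $\Lambda$ or $h$ being understood as an arbitrary accumulation point, $$M(\beta,h,A)=\lim_{n\to\infty}\langle\mathcal M_{\Lambda_n}\rangle_{\Lambda_n}(\beta,h,A),\qquad M(\beta,A)=\lim_{h\downarrow0}M(\beta,h,A),\qquad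 \sigma(\beta,A)=\lim_{n\to\infty}\sqrt{\langle(\mathcal M_{\Lambda_n})^2\rangle_{\Lambda_n}(\beta,0,A)}.$$ For $\kappa>0$ let $\mathrm{Av}_{\Lambda,\kappa}$ be the expectation over gauge fields on the bonds of $\Lambda$ with probability density proportional to $\exp[\kappa\sum_p\cos B_p]$ with respect to $\prod_b dA_b$ on $[-\pi,\pi]^{\mathcal B}$, where $\mathcal B$ is the set of bonds of $\Lambda$ and $B_p$ is the flux of $A$ through the plaquette $p$ of $\Lambda$. **Theorem.** The limit distribution $P$ of the gauge field, as $\kappa\nearrow\infty$ and then $\Lambda_n\nearrow\mathbb Z^d$, exists: there is a (necessarily unique) probability measure $P$ on the gauge fields on $\mathbb Z^d$ such that $$\lim_{n\to\infty}\lim_{\kappa\nearrow\infty}\mathrm{Av}_{\Lambda_n,\kappa}[f]=\int f\,dP$$ for every continuous function $f$ of finitely many bond variables. For every $\beta>0$ and $P$-almost every $A$, the spontaneous magnetization $M(\beta,A)$ and the long-range order $\sigma(\beta,A)$ for the Cooper pair both vanish: the set of all accumulation points defining $M(\beta,A)$ is $\{0\}$, and the set of all accumulation points defining $\sigma(\beta,A)$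 is $\{0\}$. -/

import Mathlib

open MeasureTheory Filter Topology
open scoped Matrix

noncomputable section

namespace QuenchedGauge

/-! ## Lattice geometry -/

/-- Sites of the hypercubic lattice `ℤ^d`. -/
abbrev Site (d : ℕ) : Type := Fin d → ℤ

/-- Unit vector in the `i`-th direction. -/
def unitVec {d : ℕ} (i : Fin d) : Site d := Pi.single i 1

/-- Graph distance on `ℤ^d` (nearest neighbours are the pairs at distance `1`). -/
def latticeDist {d : ℕ} (x y : Site d) : ℕ := ∑ i, (x i - y i).natAbs

/-- Positively oriented bonds of `ℤ^d`: the pair `(x, i)` stands for the bond `⟨x, x + e_i⟩`. -/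
abbrev Bond (d : ℕ) : Type := Site d × Fin d

/-- Bonds of the finite lattice `Λ`: both end points belong to `Λ`. -/
def bonds {d : ℕ} (Λ : Finset (Site d)) : Finset (Bond d) :=
  (Λ ×ˢ Finset.univ).filter fun b => b.1 + unitVec b.2 ∈ Λ

/-- Plaquettes (unit squares) of `Λ`: the triple `(x, i, j)` with `i < j` stands for the square with
corners `x, x + e_i, x + e_j, x + e_i + e_j`, all of which have to belong to `Λ`. -/
def plaquettes {d : ℕ} (Λ : Finset (Site d)) : Finset (Site d × Fin d × Fin d) :=
  (Λ ×ˢ (Finset.univ ×ˢ Finset.univ)).filter fun p =>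
    p.2.1 < p.2.2 ∧ p.1 + unitVec p.2.1 ∈ Λ ∧ p.1 + unitVec p.2.2 ∈ Λ ∧
      p.1 + unitVec p.2.1 + unitVec p.2.2 ∈ Λ

/-! ## Gauge fields -/

instance factTwoPiPos : Fact (0 < 2 * Real.pi) := ⟨Real.two_pi_pos⟩

/-- Real numbers modulo `2π`. -/
abbrev Angle : Type := AddCircle (2 * Real.pi)

/-- The cosine on `ℝ mod 2π`. -/
def angleCos : Angle → ℝ := Real.cos_periodic.lift

/-- `U(1)` gauge fields on all of `ℤ^d`: `A (x, i)` is the value `A_{x, x + e_i}`. -/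
abbrev GaugeField (d : ℕ) : Type := Bond d → Angle

/-- The value `A_{x,y}` on an oriented nearest neighbour pair, with `A_{y,x} = - A_{x,y}`
(and `0` if `x, y` are not nearest neighbours). -/
def link {d : ℕ} (A : GaugeField d) (x y : Site d) : Angle :=
  ∑ i, if y = x + unitVec i then A (x, i) else if x = y + unitVec i then -A (y, i) else 0

/-- Magnetic flux `B_p` through the plaquette `p = (x, i, j)`. -/
def flux {d : ℕ} (A : GaugeField d) (p : Site d × Fin d × Fin d) : Angle :=
  A (p.1, p.2.1) + A (p.1 + unitVec p.2.1, p.2.2)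
    - A (p.1 + unitVec p.2.2, p.2.1) - A (p.1, p.2.2)

/-- `∑_p cos B_p`, over the plaquettes of `Λ`. -/
def plaquetteSum {d : ℕ} (Λ : Finset (Site d)) (A : GaugeField d) : ℝ :=
  ∑ p ∈ plaquettes Λ, angleCos (flux A p)

/-- Gauge fields on the bonds of the finite lattice `Λ`, with the product measure
`∏_b dA_b` as `volume`. -/
abbrev LocalField {d : ℕ} (Λ : Finset (Site d)) : Type := {b // b ∈ bonds Λ} → Angle

/-- Extension by zero of a gauge field on `Λ` to all of `ℤ^d`. -/
def extend {d : ℕ} (Λ : Finset (Site d)) (a : LocalField Λ) : GaugeField d :=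
  fun b => if hb : b ∈ bonds Λ then a ⟨b, hb⟩ else 0

/-- The average `Av_{Λ,κ}[f]`, that is the expectation with respect to the probability density
`exp (κ ∑_p cos B_p) / ∫ ∏_b dA_b exp (κ ∑_p cos B_p)` on `[-π, π]^{bonds of Λ}`. -/
def gaugeAverage {d : ℕ} (Λ : Finset (Site d)) (κ : ℝ) (f : GaugeField d → ℝ) : ℝ :=
  (∫ a : LocalField Λ, Real.exp (κ * plaquetteSum Λ (extend Λ a)) * f (extend Λ a)) /
    ∫ a : LocalField Λ, Real.exp (κ * plaquetteSum Λ (extend Λ a))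

/-- `P` is the distribution of the gauge field in the limit `κ ↗ ∞` followed by `Λ ↗ ℤ^d`:
`lim_n lim_{κ ↗ ∞} Av_{Λ_n,κ}[f] = ∫ f dP` for every continuous `f`, where the inner limits exist.
Continuity is for the product topology, in which every continuous function is a uniform limit of
functions of finitely many bond variables; so the extension by zero outside `Λ_n` plays no role,
and there is at most one such probability measure `P`. -/
def IsZeroFluxLimit {d : ℕ} (Λ : ℕ → Finset (Site d)) (P : Measure (GaugeField d)) : Prop :=
  ∀ f : GaugeField d → ℝ, Continuous f →
    ∃ g : ℕ → ℝ, (∀ n, Tendsto (fun κ : ℝ => gaugeAverage (Λ n) κ f) atTop (𝓝 (g n))) ∧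
      Tendsto g atTop (𝓝 (∫ A, f A ∂P))

/-! ## Fermions -/

/-- Spin index. -/
abbrev Spin : Type := Fin 2

/-- Spin up. -/
def up : Spin := 0

/-- Spin down. -/
def down : Spin := 1

/-- One-particle modes of the electrons on `Λ`. -/
abbrev Mode {d : ℕ} (Λ : Finset (Site d)) : Type := {x // x ∈ Λ} × Spin

/-- Operators on the fermionic Fock space over `Λ`, as matrices in the occupation number basis:
a basis vector is given by the set of occupied modes. -/
abbrev FockOp {d : ℕ} (Λ : Finset (Site d)) : Type :=
  Matrix (Finset (Mode Λ)) (Finset (Mode Λ)) ℂ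

/-- The linear (lexicographic) order of the modes that fixes the fermionic signs. -/
def modeKey {d : ℕ} {Λ : Finset (Site d)} (m : Mode Λ) : Lex (Lex (Fin d → ℤ) × Spin) :=
  toLex (toLex m.1.1, m.2)

/-- Annihilation operator of the mode `m`:
`c_m |S⟩ = (-1)^{#{j ∈ S : j < m}} |S \ {m}⟩` if `m ∈ S`, and `c_m |S⟩ = 0` otherwise. -/
def annih {d : ℕ} {Λ : Finset (Site d)} (m : Mode Λ) : FockOp Λ :=
  Matrix.of fun S' S =>
    if m ∈ S ∧ S' = S.erase m then (-1) ^ (S.filter fun j => modeKey j < modeKey m).card else 0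

/-- Creation operator of the mode `m`. -/
def create {d : ℕ} {Λ : Finset (Site d)} (m : Mode Λ) : FockOp Λ := (annih m)ᴴ

/-- Number operator of the mode `m`. -/
def num {d : ℕ} {Λ : Finset (Site d)} (m : Mode Λ) : FockOp Λ := create m * annih m

/-- The data of a tight-binding model of electrons on `ℤ^d`: nearest neighbour hopping amplitudes,
density interactions of up to `order` factors, the chemical potential, and the neighbourhoods `𝒩_x`
in which Cooper pairs are formed. Hopping and interactions are bounded, and interactions and
neighbourhoods are of finite range. -/
structure Model (d : ℕ) where
  /-- Hopping amplitudes `t_{x,y}^{α,β}`. -/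
  t : Site d → Site d → Spin → Spin → ℂ
  /-- Maximal number of factors in an interaction term. -/
  order : ℕ
  /-- Coupling constants `W_{x₁,σ₁;…;x_I,σ_I}`. -/
  W : (I : ℕ) → (Fin I → Site d × Spin) → ℝ
  /-- Chemical potential. -/
  μ : ℝ
  /-- The neighbourhood `𝒩_x` of the site `x`. -/
  nbhd : Site d → Finset (Site d)
  t_hermitian : ∀ x y α β, t y x β α = (starRingEnd ℂ) (t x y α β)
  t_nearest : ∀ x y α β, t x y α β ≠ 0 → latticeDist x y = 1
  t_bounded : ∃ t₀ : ℝ, ∀ x y α β, ‖t x y α β‖ ≤ t₀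
  W_range : ∃ r : ℕ, ∀ I w, W I w ≠ 0 → ∀ k l, latticeDist (w k).1 (w l).1 ≤ r
  W_bounded : ∃ W₀ : ℝ, ∀ I w, |W I w| ≤ W₀
  nbhd_range : ∃ r : ℕ, ∀ x, ∀ y ∈ nbhd x, latticeDist x y ≤ r

namespace Model

variable {d : ℕ} (model : Model d) (Λ : Finset (Site d))

/-- The hopping term, with amplitudes `t_{x,y}^{α,β} exp (i A_{x,y})`. -/
def hopping (A : GaugeField d) : FockOp Λ :=
  ∑ x : {x // x ∈ Λ}, ∑ y : {x // x ∈ Λ}, ∑ α : Spin, ∑ β : Spin,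
    (model.t x.1 y.1 α β * ((link A x.1 y.1).toCircle : ℂ)) •
      (create (x, α) * annih (y, β))

/-- The interaction term
`∑_{I ≥ 1} ∑_{x₁,σ₁} ⋯ ∑_{x_I,σ_I} W_{x₁,σ₁;…;x_I,σ_I} n_{x₁,σ₁} ⋯ n_{x_I,σ_I}`. -/
def interaction : FockOp Λ :=
  ∑ I ∈ Finset.Icc 1 model.order, ∑ w : Fin I → Mode Λ,
    ((model.W I (fun k => ((w k).1.1, (w k).2)) : ℝ) : ℂ) •
      (List.ofFn fun k => num (w k)).prod

/-- The Hamiltonian of the symmetry breaking field,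
`∑_{x ∈ Λ} ∑_{y ∈ 𝒩_x} (c_{x,↑} c_{y,↓} + c_{y,↓}^† c_{x,↑}^†)`. -/
def pairing : FockOp Λ :=
  ∑ x : {x // x ∈ Λ}, ∑ y : {x // x ∈ Λ},
    if y.1 ∈ model.nbhd x.1 then
      annih (x, up) * annih (y, down) + create (y, down) * create (x, up)
    else 0

/-- The Hamiltonian `H_Λ(A) - μ N_Λ - h H_{ext,Λ}`. -/
def hamiltonian (h : ℝ) (A : GaugeField d) : FockOp Λ :=
  model.hopping Λ A + model.interaction Λ - (model.μ : ℂ) • (∑ m : Mode Λ, num m)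
    - (h : ℂ) • model.pairing Λ

/-- The Boltzmann operator `exp (-β (H_Λ(A) - μ N_Λ - h H_{ext,Λ}))`. -/
def boltzmann (β h : ℝ) (A : GaugeField d) : FockOp Λ :=
  NormedSpace.exp ((-β : ℂ) • model.hamiltonian Λ h A)

/-- The thermal expectation value `⟨O⟩_Λ(β, h, A)`. -/
def expect (β h : ℝ) (A : GaugeField d) (O : FockOp Λ) : ℂ :=
  (O * model.boltzmann Λ β h A).trace / (model.boltzmann Λ β h A).trace

/-- The order parameter
`|Λ|⁻¹ ∑_{x ∈ Λ} ∑_{y ∈ 𝒩_x} (c_{x,↑} c_{y,↓} + c_{y,↓}^† c_{x,↑}^†)`. -/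
def orderParameter : FockOp Λ := ((Λ.card : ℂ)⁻¹) • model.pairing Λ

/-- The magnetization of the finite system (a real number, as the order parameter
is self-adjoint). -/
def magnetization (β h : ℝ) (A : GaugeField d) : ℝ :=
  (model.expect Λ β h A (model.orderParameter Λ)).re

/-- The square root of the expectation value of the square of the order parameter without
symmetry breaking field (the expectation value is a nonnegative real number). -/
def orderCorrelation (β : ℝ) (A : GaugeField d) : ℝ :=
  Real.sqrt (model.expect Λ β 0 A (model.orderParameter Λ ^ 2)).re

/-- All values of `M(β, h, A) = lim_n ⟨M_{Λ_n}⟩(β, h, A)`, the limit being understood as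
an arbitrary accumulation point. -/
def magnetizationLimits (Λ : ℕ → Finset (Site d)) (β h : ℝ) (A : GaugeField d) : Set ℝ :=
  {m | MapClusterPt m atTop fun n => model.magnetization (Λ n) β h A}

/-- All values of the spontaneous magnetization `M(β, A) = lim_{h ↓ 0} M(β, h, A)`: the
accumulation points, as `h ↓ 0`, of arbitrary values of `M(β, h, A)`. -/
def spontaneousMagnetization (Λ : ℕ → Finset (Site d)) (β : ℝ) (A : GaugeField d) : Set ℝ :=
  {m | ∃ (h : ℕ → ℝ) (v : ℕ → ℝ), (∀ k, 0 < h k) ∧ Tendsto h atTop (𝓝 0) ∧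
    (∀ k, v k ∈ model.magnetizationLimits Λ β (h k) A) ∧ Tendsto v atTop (𝓝 m)}

/-- All values of the long-range order
`σ(β, A) = lim_n (⟨(M_{Λ_n})²⟩(β, 0, A))^{1/2}`, as accumulation points. -/
def longRangeOrder (Λ : ℕ → Finset (Site d)) (β : ℝ) (A : GaugeField d) : Set ℝ :=
  {s | MapClusterPt s atTop fun n => model.orderCorrelation (Λ n) β A}

end Model

end QuenchedGauge

end

/-!
The limit of the gauge field is the law `P` of a pure gauge field `A_{x,y} = θ_y - θ_x` whose gauge
function `θ` is distributed according to the Haar measure, that is, with independent and uniform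
values. In finite volume the weight `exp (κ ∑_p cos B_p)` is invariant under the closed subgroup of
fields without flux, and its maximizers form exactly this subgroup. As `κ → ∞` the gauge field
becomes Haar distributed on it (`tendsto_gaugeAverage`), whatever the shape of `Λ`. On a box inside
a large `Λ` a field without flux is a pure gauge field, by the Poincaré lemma
(`exists_pureGauge_eq_of_flux_eq_zero`). As the Haar measure is invariant under gauge
transformations, the law on the bonds of the box is that of a uniformly distributed pure gauge field
(`isZeroFluxLimit_zeroFluxMeasure`).

A pure gauge field can be removed from the Hamiltonian by a unitary transformation, which moves it
into random phases `e^{i(θ_x + θ_y)}` of the Cooper pairs in the pairing operator. Averaging over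
the four rotations of the phase at one site `x` by multiples of `π / 2` removes the pairs containing
`x`, which carry charge one or two at `x`, to first order (`Model.exists_pairingOn_insert`). The
second order is controlled by trace inequalities that reduce to inequalities between numbers in the
eigenbases of the two exponents: averaging `tr e^{K + V}` over perturbations `V` of mean zero costs
at most a factor `e^{2‖V‖²}` (`sum_trace_exp_add_le`), and averaging `(⟨(S + V)²⟩ + N)²` costs at
most a factor `e^{C/N}` (`sum_gibbsSquare_add_sq_le`). Treating the sites one after the other gives
`E[Z(h)] ≤ e^{2(βhc)²|Λ|} Z(0)` and `E[⟨H_ext²⟩²] ≤ C |Λ|²`.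

Both bounds give probabilities summable in `|Λ|`, and the members of an increasing sequence of
finite sets are determined by their cardinality, so the Borel–Cantelli lemma applies. Hence, almost
surely, eventually `Z(h) ≤ e^{3(βhc)²|Λ|} Z(0)`, for all small rational `h > 0`, and
`⟨H_ext²⟩ = o(|Λ|²)`. The latter says that there is no long-range order. By convexity of the free
energy (`peierls_bogoliubov`), and since the magnetization vanishes at `h = 0` by the global `U(1)`
symmetry, the former gives `0 ≤ M(β, h, A) ≤ 27 β c² h`, and the spontaneous magnetization vanishes
as `h ↓ 0`.
-/

namespace QuenchedGauge

open scoped Matrix.Norms.L2Operator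

/-! ### Trace inequalities for Gibbs weights -/

section TraceInequalities

variable {n : Type*} [Fintype n] [DecidableEq n] {A B : Matrix n n ℂ}

/-- The traces `tr (f(A) g(B))` are double sums over the eigenvalues `a i` of `A` and `b j` of `B`,
with the squared overlaps of the eigenvectors as weights. Inequalities between numbers thus become
inequalities between traces. -/
theorem exists_transition_weights (hA : A.IsHermitian) (hB : B.IsHermitian) :
    ∃ (w : n → n → ℝ) (a b : n → ℝ), (∀ i j, 0 ≤ w i j) ∧
      ∀ f g : ℝ → ℝ, (cfc f A * cfc g B).trace.re = ∑ i, ∑ j, w i j * (f (a i) * g (b j)) := by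
  set U : Matrix n n ℂ := (hA.eigenvectorUnitary : Matrix n n ℂ) with hU
  set W : Matrix n n ℂ := (hB.eigenvectorUnitary : Matrix n n ℂ) with hW
  refine ⟨fun i j => ‖(Uᴴ * W) i j‖ ^ 2, hA.eigenvalues, hB.eigenvalues,
    fun i j => by positivity, fun f g => ?_⟩
  have h1 : cfc f A = U * Matrix.diagonal (fun i => (f (hA.eigenvalues i) : ℂ)) * Uᴴ := by
    rw [hA.cfc_eq]; rfl
  have h2 : cfc g B = W * Matrix.diagonal (fun i => (g (hB.eigenvalues i) : ℂ)) * Wᴴ := by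
    rw [hB.cfc_eq]; rfl
  have h3 : (cfc f A * cfc g B).trace =
      (Matrix.diagonal (fun i => (f (hA.eigenvalues i) : ℂ)) * ((Uᴴ * W) *
        Matrix.diagonal (fun i => (g (hB.eigenvalues i) : ℂ)) * (Uᴴ * W)ᴴ)).trace := by
    rw [h1, h2, Matrix.mul_assoc, Matrix.mul_assoc, Matrix.trace_mul_comm]
    simp only [Matrix.conjTranspose_mul, Matrix.conjTranspose_conjTranspose, Matrix.mul_assoc]
  rw [h3, Matrix.trace, Complex.re_sum]
  refine Finset.sum_congr rfl fun i _ => ?_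
  rw [Matrix.diag_apply, Matrix.diagonal_mul, Matrix.mul_apply, Complex.re_ofReal_mul,
    Complex.re_sum, Finset.mul_sum]
  refine Finset.sum_congr rfl fun j _ => ?_
  rw [Matrix.mul_diagonal, Matrix.conjTranspose_apply, mul_right_comm, Complex.star_def,
    Complex.mul_conj, Complex.normSq_eq_norm_sq, ← Complex.ofReal_mul, Complex.ofReal_re]
  ring

theorem exp_eq_cfc_exp (hA : A.IsHermitian) : NormedSpace.exp A = cfc Real.exp A :=
  (CFC.real_exp_eq_normedSpace_exp (a := A) hA.isSelfAdjoint).symm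

theorem mul_exp_eq_cfc (hA : A.IsHermitian) :
    A * NormedSpace.exp A = cfc (fun x => x * Real.exp x) A := by
  rw [cfc_mul (fun x : ℝ => x) Real.exp A, cfc_id' ℝ A hA.isSelfAdjoint, exp_eq_cfc_exp hA]

theorem commute_exp : Commute A (NormedSpace.exp A) := (Commute.refl A).exp_right

/-- The trace of `e^A` is a positive real number. -/
theorem trace_exp_re_pos [Nonempty n] (hA : A.IsHermitian) :
    0 < (NormedSpace.exp A).trace.re := by
  rw [exp_eq_cfc_exp hA, hA.cfc_eq, Matrix.IsHermitian.cfc, Unitary.conjStarAlgAut_apply,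
    Matrix.trace_mul_comm, ← mul_assoc, Unitary.coe_star_mul_self, one_mul, Matrix.trace_diagonal,
    Complex.re_sum]
  exact Finset.sum_pos (fun i _ => Real.exp_pos _) Finset.univ_nonempty

omit [DecidableEq n] in
theorem trace_im_eq_zero (hA : A.IsHermitian) : A.trace.im = 0 := by
  have h := Matrix.trace_conjTranspose A
  rw [hA.eq] at h
  exact Complex.conj_eq_iff_im.mp h.symm

omit [DecidableEq n] in
theorem trace_mul_re_comm (hA : A.IsHermitian) (hB : B.IsHermitian) (C : Matrix n n ℂ)
    (hC : C.IsHermitian) : (A * B * C).trace.re = (B * A * C).trace.re := by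
  have h : (A * B * C).trace = star (B * A * C).trace := by
    rw [← Matrix.trace_conjTranspose, Matrix.conjTranspose_mul, Matrix.conjTranspose_mul, hA.eq,
      hB.eq, hC.eq, Matrix.trace_mul_comm]
  rw [h]; rfl

/-- Klein's inequality for the exponential function. -/
theorem klein_exp (hA : A.IsHermitian) (hB : B.IsHermitian) :
    (NormedSpace.exp A).trace.re + ((B - A) * NormedSpace.exp A).trace.re ≤
      (NormedSpace.exp B).trace.re := by
  obtain ⟨w, a, b, hw, H⟩ := exists_transition_weights hA hB
  have e1 : (NormedSpace.exp A).trace.re = ∑ i, ∑ j, w i j * (Real.exp (a i) * 1) := by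
    rw [← H Real.exp (fun _ => 1), cfc_const_one ℝ B hB.isSelfAdjoint, mul_one, exp_eq_cfc_exp hA]
  have e2 : (NormedSpace.exp B).trace.re = ∑ i, ∑ j, w i j * (1 * Real.exp (b j)) := by
    rw [← H (fun _ => 1) Real.exp, cfc_const_one ℝ A hA.isSelfAdjoint, one_mul, exp_eq_cfc_exp hB]
  have e3 : (B * NormedSpace.exp A).trace.re = ∑ i, ∑ j, w i j * (Real.exp (a i) * b j) := by
    rw [← H Real.exp (fun x => x), cfc_id' ℝ B hB.isSelfAdjoint, ← exp_eq_cfc_exp hA,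
      Matrix.trace_mul_comm]
  have e4 : (A * NormedSpace.exp A).trace.re =
      ∑ i, ∑ j, w i j * ((a i * Real.exp (a i)) * 1) := by
    rw [← H (fun x => x * Real.exp x) (fun _ => 1), cfc_const_one ℝ B hB.isSelfAdjoint, mul_one,
      mul_exp_eq_cfc hA]
  rw [Matrix.sub_mul, Matrix.trace_sub, Complex.sub_re, e1, e2, e3, e4, ← Finset.sum_sub_distrib,
    ← Finset.sum_add_distrib]
  refine Finset.sum_le_sum fun i _ => ?_
  rw [← Finset.sum_sub_distrib, ← Finset.sum_add_distrib]
  refine Finset.sum_le_sum fun j _ => ?_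
  have h1 : Real.exp (b j) = Real.exp (a i) * Real.exp (b j - a i) := by
    rw [← Real.exp_add]; ring_nf
  have h2 := mul_le_mul_of_nonneg_left (Real.add_one_le_exp (b j - a i)) (Real.exp_pos (a i)).le
  have h3 := mul_le_mul_of_nonneg_left h2 (hw i j)
  rw [h1]
  linarith

/-- The trapezoidal bound `(y - x) (e^y - e^x) ≤ (y - x)² (e^x + e^y) / 2`. -/
theorem sub_mul_exp_sub_exp_le (x y : ℝ) :
    (y - x) * (Real.exp y - Real.exp x) ≤ (y - x) ^ 2 * (Real.exp x + Real.exp y) / 2 := by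
  -- for `u ≥ 0` one has `e^u - 1 ≤ u (1 + e^u) / 2`
  have key : ∀ u : ℝ, 0 ≤ u → Real.exp u - 1 ≤ u * (1 + Real.exp u) / 2 := by
    intro u hu
    let f : ℝ → ℝ := fun u => u * (1 + Real.exp u) / 2 - Real.exp u + 1
    have hf : ∀ u, HasDerivAt f ((1 * (1 + Real.exp u) + u * Real.exp u) / 2 - Real.exp u) u := by
      intro u
      have h1 := ((hasDerivAt_id u).mul ((Real.hasDerivAt_exp u).const_add 1)).div_const 2
      exact ((h1.sub (Real.hasDerivAt_exp u)).add_const 1)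
    have hmono : MonotoneOn f (Set.Ici 0) := by
      apply monotoneOn_of_deriv_nonneg (convex_Ici 0)
      · exact fun u _ => (hf u).continuousAt.continuousWithinAt
      · exact fun u _ => (hf u).differentiableAt.differentiableWithinAt
      · intro u hu
        rw [(hf u).deriv]
        have h1 := Real.add_one_le_exp (-u)
        have h2 : Real.exp (-u) * Real.exp u = 1 := by rw [← Real.exp_add]; simp
        have h3 := mul_le_mul_of_nonneg_right h1 (Real.exp_pos u).le
        nlinarith
    have h0 := hmono (Set.mem_Ici.mpr le_rfl) (Set.mem_Ici.mpr hu) hu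
    simp only [f] at h0
    simp at h0
    linarith
  have main : ∀ x y : ℝ, x ≤ y →
      (y - x) * (Real.exp y - Real.exp x) ≤ (y - x) ^ 2 * (Real.exp x + Real.exp y) / 2 := by
    intro x y hxy
    have h1 : Real.exp y = Real.exp x * Real.exp (y - x) := by rw [← Real.exp_add]; ring_nf
    have h2 := mul_le_mul_of_nonneg_left (key (y - x) (by linarith))
      (mul_nonneg (sub_nonneg.mpr hxy) (Real.exp_pos x).le)
    rw [h1]
    linarith
  rcases le_total x y with h | h
  · exact main x y h
  · have := main y x h
    linarith [this]

/-- The operator version of the trapezoidal bound: in the eigenbases of `A` and `B` both sides are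
sums over pairs of eigenvalues with the same nonnegative weights. -/
theorem trace_sub_mul_exp_sub_exp_le (hA : A.IsHermitian) (hB : B.IsHermitian) :
    ((B - A) * NormedSpace.exp B).trace.re - ((B - A) * NormedSpace.exp A).trace.re ≤
      (((B - A) * (B - A) * NormedSpace.exp A).trace.re +
        ((B - A) * (B - A) * NormedSpace.exp B).trace.re) / 2 := by
  obtain ⟨w, a, b, hw, H⟩ := exists_transition_weights hA hB
  have id1 : cfc (fun x : ℝ => x) A = A := cfc_id' ℝ A hA.isSelfAdjoint
  have id2 : cfc (fun x : ℝ => x) B = B := cfc_id' ℝ B hB.isSelfAdjoint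
  have sq1 : cfc (fun x : ℝ => x * x) A = A * A := by
    rw [cfc_mul (fun x : ℝ => x) (fun x : ℝ => x) A, id1]
  have sq2 : cfc (fun x : ℝ => x * x) B = B * B := by
    rw [cfc_mul (fun x : ℝ => x) (fun x : ℝ => x) B, id2]
  have one1 : cfc (fun _ : ℝ => (1 : ℝ)) A = 1 := cfc_const_one ℝ A hA.isSelfAdjoint
  have one2 : cfc (fun _ : ℝ => (1 : ℝ)) B = 1 := cfc_const_one ℝ B hB.isSelfAdjoint
  have me1 := mul_exp_eq_cfc hA
  have me2 := mul_exp_eq_cfc hB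
  have mme1 : A * (A * NormedSpace.exp A) = cfc (fun x => x * (x * Real.exp x)) A := by
    rw [cfc_mul (fun x : ℝ => x) (fun x => x * Real.exp x) A, id1, me1]
  have mme2 : B * (B * NormedSpace.exp B) = cfc (fun x => x * (x * Real.exp x)) B := by
    rw [cfc_mul (fun x : ℝ => x) (fun x => x * Real.exp x) B, id2, me2]
  have ee1 := exp_eq_cfc_exp hA
  have ee2 := exp_eq_cfc_exp hB
  have b1 : (B * NormedSpace.exp B).trace.re =
      ∑ i, ∑ j, w i j * (1 * (b j * Real.exp (b j))) := by
    rw [← H (fun _ => 1) (fun x => x * Real.exp x), one1, one_mul, me2]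
  have b2 : (A * NormedSpace.exp B).trace.re = ∑ i, ∑ j, w i j * (a i * Real.exp (b j)) := by
    rw [← H (fun x => x) Real.exp, id1, ← ee2]
  have b3 : (B * NormedSpace.exp A).trace.re = ∑ i, ∑ j, w i j * (Real.exp (a i) * b j) := by
    rw [← H Real.exp (fun x => x), id2, ← ee1, Matrix.trace_mul_comm]
  have b4 : (A * NormedSpace.exp A).trace.re =
      ∑ i, ∑ j, w i j * ((a i * Real.exp (a i)) * 1) := by
    rw [← H (fun x => x * Real.exp x) (fun _ => 1), one2, mul_one, me1]
  have c1 : ((B - A) * (B - A) * NormedSpace.exp A).trace.re =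
      ∑ i, ∑ j, w i j * (Real.exp (a i) * (b j * b j))
        - 2 * ∑ i, ∑ j, w i j * ((a i * Real.exp (a i)) * b j)
        + ∑ i, ∑ j, w i j * ((a i * (a i * Real.exp (a i))) * 1) := by
    rw [← H Real.exp (fun x => x * x), ← H (fun x => x * Real.exp x) (fun x => x),
      ← H (fun x => x * (x * Real.exp x)) (fun _ => 1), one2, mul_one, id2, sq2, ← ee1, ← me1,
      ← mme1]
    have e : (B - A) * (B - A) * NormedSpace.exp A = B * B * NormedSpace.exp A
        - B * (A * NormedSpace.exp A) - A * B * NormedSpace.exp A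
        + A * (A * NormedSpace.exp A) := by noncomm_ring
    have e' : (A * B * NormedSpace.exp A).trace = (A * NormedSpace.exp A * B).trace := by
      rw [mul_assoc, Matrix.trace_mul_comm, mul_assoc, commute_exp.eq, Matrix.trace_mul_comm]
    rw [e, Matrix.trace_add, Matrix.trace_sub, Matrix.trace_sub, e',
      Matrix.trace_mul_comm (B * B), Matrix.trace_mul_comm B]
    simp only [Complex.add_re, Complex.sub_re]
    ring
  have c2 : ((B - A) * (B - A) * NormedSpace.exp B).trace.re =
      ∑ i, ∑ j, w i j * ((a i * a i) * Real.exp (b j))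
        - 2 * ∑ i, ∑ j, w i j * (a i * (b j * Real.exp (b j)))
        + ∑ i, ∑ j, w i j * (1 * (b j * (b j * Real.exp (b j)))) := by
    rw [← H (fun x => x * x) Real.exp, ← H (fun x => x) (fun x => x * Real.exp x),
      ← H (fun _ => 1) (fun x => x * (x * Real.exp x)), one1, one_mul, id1, sq1, ← ee2, ← me2,
      ← mme2]
    have e : (B - A) * (B - A) * NormedSpace.exp B = A * A * NormedSpace.exp B
        - A * (B * NormedSpace.exp B) - B * A * NormedSpace.exp B
        + B * (B * NormedSpace.exp B) := by noncomm_ring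
    have e' : (B * A * NormedSpace.exp B).trace = (A * (B * NormedSpace.exp B)).trace := by
      rw [mul_assoc, Matrix.trace_mul_comm, mul_assoc, commute_exp.eq]
    rw [e, Matrix.trace_add, Matrix.trace_sub, Matrix.trace_sub, e']
    simp only [Complex.add_re, Complex.sub_re]
    ring
  rw [c1, c2, Matrix.sub_mul, Matrix.trace_sub, Matrix.sub_mul, Matrix.trace_sub, Complex.sub_re,
    Complex.sub_re, b1, b2, b3, b4]
  simp only [Finset.mul_sum, ← Finset.sum_sub_distrib, ← Finset.sum_add_distrib, Finset.sum_div]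
  refine Finset.sum_le_sum fun i _ => Finset.sum_le_sum fun j _ => ?_
  have h := mul_le_mul_of_nonneg_left (sub_mul_exp_sub_exp_le (a i) (b j)) (hw i j)
  linarith

omit [DecidableEq n] in
theorem trace_conjTranspose_mul_self_re (M : Matrix n n ℂ) :
    (Mᴴ * M).trace.re = ∑ j, ‖(WithLp.toLp 2 (fun i => M i j) : EuclideanSpace ℂ n)‖ ^ 2 := by
  rw [Matrix.trace, Complex.re_sum]
  refine Finset.sum_congr rfl fun j _ => ?_
  rw [EuclideanSpace.norm_sq_eq, Matrix.diag_apply, Matrix.mul_apply, Complex.re_sum]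
  refine Finset.sum_congr rfl fun i _ => ?_
  rw [Matrix.conjTranspose_apply, mul_comm, Complex.star_def, Complex.mul_conj,
    Complex.normSq_eq_norm_sq, Complex.ofReal_re]

/-- Moving one half of `e^A` to the left turns `tr (Vᴴ V e^A)` into a Hilbert–Schmidt norm. -/
theorem exists_trace_conjTranspose_mul_self_mul_exp (hA : A.IsHermitian) :
    ∃ E : Matrix n n ℂ, ∀ V : Matrix n n ℂ,
      (Vᴴ * V * NormedSpace.exp A).trace = ((V * E)ᴴ * (V * E)).trace := by
  have hA2 : ((2⁻¹ : ℝ) • A).IsHermitian := by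
    rw [Matrix.IsHermitian, Matrix.conjTranspose_smul, hA.eq, star_trivial]
  refine ⟨NormedSpace.exp ((2⁻¹ : ℝ) • A), fun V => ?_⟩
  have h1 : NormedSpace.exp A =
      NormedSpace.exp ((2⁻¹ : ℝ) • A) * NormedSpace.exp ((2⁻¹ : ℝ) • A) := by
    rw [← Matrix.exp_add_of_commute _ _ (Commute.refl _), ← add_smul]
    norm_num
  rw [h1, Matrix.conjTranspose_mul, hA2.exp.eq, ← mul_assoc, Matrix.trace_mul_comm]
  simp only [mul_assoc]

theorem trace_conjTranspose_mul_self_mul_exp_nonneg (hA : A.IsHermitian) (V : Matrix n n ℂ) :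
    0 ≤ (Vᴴ * V * NormedSpace.exp A).trace.re := by
  obtain ⟨E, hE⟩ := exists_trace_conjTranspose_mul_self_mul_exp hA
  rw [hE, trace_conjTranspose_mul_self_re]
  positivity

theorem trace_sq_mul_exp_le (hA : A.IsHermitian) {V : Matrix n n ℂ} (hV : V.IsHermitian) {c : ℝ}
    (hc : ‖V‖ ≤ c) :
    (V * V * NormedSpace.exp A).trace.re ≤ c ^ 2 * (NormedSpace.exp A).trace.re := by
  obtain ⟨E, hE⟩ := exists_trace_conjTranspose_mul_self_mul_exp hA
  have h1 := hE V
  rw [hV.eq] at h1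
  have h2 := hE 1
  rw [Matrix.conjTranspose_one, one_mul, one_mul, one_mul] at h2
  rw [h1, h2, trace_conjTranspose_mul_self_re, trace_conjTranspose_mul_self_re, Finset.mul_sum]
  refine Finset.sum_le_sum fun j _ => ?_
  have h3 := Matrix.l2_opNorm_mulVec V (WithLp.toLp 2 (fun i => E i j))
  have h4 : (WithLp.toLp 2 (fun i => (V * E) i j) : EuclideanSpace ℂ n) =
      (EuclideanSpace.equiv n ℂ).symm
        (V *ᵥ (WithLp.toLp 2 (fun i => E i j) : EuclideanSpace ℂ n).ofLp) := by
    ext i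
    simp [Matrix.mul_apply, Matrix.mulVec, dotProduct]
  rw [h4, ← mul_pow]
  gcongr
  exact h3.trans (by gcongr)

theorem exp_add_smul_one (t : ℝ) :
    NormedSpace.exp (A + (t : ℂ) • (1 : Matrix n n ℂ)) = (Real.exp t : ℂ) • NormedSpace.exp A := by
  have h : NormedSpace.exp ((t : ℂ) • (1 : Matrix n n ℂ)) = (Real.exp t : ℂ) • 1 := by
    rw [← Algebra.algebraMap_eq_smul_one, ← NormedSpace.algebraMap_exp_comm,
      Algebra.algebraMap_eq_smul_one, ← Complex.exp_eq_exp_ℂ, Complex.ofReal_exp]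
  rw [Matrix.exp_add_of_commute _ _ ((Commute.one_right A).smul_right _), h, mul_smul_comm, mul_one]

/-- The Peierls–Bogoliubov inequality. -/
theorem peierls_bogoliubov [Nonempty n] (hA : A.IsHermitian) (hB : B.IsHermitian) :
    Real.exp ((B * NormedSpace.exp A).trace.re / (NormedSpace.exp A).trace.re) *
      (NormedSpace.exp A).trace.re ≤ (NormedSpace.exp (A + B)).trace.re := by
  have hZ := trace_exp_re_pos hA
  set Z := (NormedSpace.exp A).trace.re with hZdef
  set t : ℝ := (B * NormedSpace.exp A).trace.re / Z with ht
  have hA' : (A + (t : ℂ) • (1 : Matrix n n ℂ)).IsHermitian := by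
    refine hA.add ?_
    rw [Matrix.IsHermitian, Matrix.conjTranspose_smul, Matrix.conjTranspose_one, Complex.star_def,
      Complex.conj_ofReal]
  -- subtracting from `B` its expectation value `t` removes the linear term
  have h := klein_exp hA' (hA.add hB)
  have e : (A + B - (A + (t : ℂ) • (1 : Matrix n n ℂ))) = B - (t : ℂ) • 1 := by abel
  rw [exp_add_smul_one, e, mul_smul_comm, Matrix.trace_smul, Matrix.trace_smul, Matrix.sub_mul,
    Matrix.trace_sub, smul_mul_assoc, one_mul, Matrix.trace_smul, smul_eq_mul, smul_eq_mul,
    smul_eq_mul, Complex.re_ofReal_mul, Complex.re_ofReal_mul, Complex.sub_re,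
    Complex.re_ofReal_mul, ← hZdef] at h
  have h2 : (B * NormedSpace.exp A).trace.re = t * Z := by
    rw [ht]; field_simp
  rw [h2] at h
  linarith

/-- Averaging a perturbation of mean zero costs only a second order factor in the partition
function. -/
theorem sum_trace_exp_add_le {ι : Type*} [Fintype ι] (hA : A.IsHermitian)
    {V : ι → Matrix n n ℂ} (hV : ∀ j, (V j).IsHermitian) (hsum : ∑ j, V j = 0) {c : ℝ}
    (hc : ∀ j, ‖V j‖ ≤ c) (hc1 : c ^ 2 ≤ 1) :
    ∑ j, (NormedSpace.exp (A + V j)).trace.re ≤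
      Fintype.card ι * (Real.exp (2 * c ^ 2) * (NormedSpace.exp A).trace.re) := by
  set Z := (NormedSpace.exp A).trace.re with hZdef
  have hZ : 0 ≤ Z := by
    have := trace_conjTranspose_mul_self_mul_exp_nonneg hA 1
    simpa using this
  -- Klein's inequality bounds the increment by `tr (V e^{A + V})`, the trapezoidal bound replaces
  -- this by the linear term `tr (V e^A)` and a second order remainder
  have step : ∀ j, (1 - c ^ 2 / 2) * (NormedSpace.exp (A + V j)).trace.re ≤
      (1 + c ^ 2 / 2) * Z + (V j * NormedSpace.exp A).trace.re := by
    intro j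
    have hB := hA.add (hV j)
    have h1 := klein_exp hB hA
    have h2 := trace_sub_mul_exp_sub_exp_le hA hB
    have h3 := trace_sq_mul_exp_le hA (hV j) (hc j)
    have h4 := trace_sq_mul_exp_le hB (hV j) (hc j)
    have e1 : A - (A + V j) = -V j := by abel
    have e2 : A + V j - A = V j := by abel
    rw [e1, Matrix.neg_mul, Matrix.trace_neg, Complex.neg_re] at h1
    rw [e2] at h2
    linarith
  have hsum' : ∑ j, (V j * NormedSpace.exp A).trace.re = 0 := by
    rw [← Complex.re_sum, ← Matrix.trace_sum, ← Finset.sum_mul, hsum]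
    simp
  have h := Finset.sum_le_sum fun j (_ : j ∈ Finset.univ) => step j
  rw [← Finset.mul_sum, Finset.sum_add_distrib, hsum', add_zero, Finset.sum_const,
    Finset.card_univ, nsmul_eq_mul] at h
  set S := ∑ j, (NormedSpace.exp (A + V j)).trace.re
  set k : ℝ := (Fintype.card ι : ℝ)
  have hk : 0 ≤ k * Z := by positivity
  set y := c ^ 2 with hy
  have hy0 : 0 ≤ y := by positivity
  -- `(1 + x) / (1 - x) ≤ 1 + 4 x ≤ e^{4x}` for `x = c² / 2 ≤ 1 / 2`
  have h5 : (1 - y / 2) * S ≤ (1 - y / 2) * ((1 + 2 * y) * (k * Z)) := by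
    refine h.trans ?_
    nlinarith [mul_nonneg hk (mul_nonneg hy0 (sub_nonneg.mpr hc1))]
  have h6 := le_of_mul_le_mul_left h5 (by linarith)
  have h7 := mul_le_mul_of_nonneg_right (Real.add_one_le_exp (2 * y)) hk
  linarith

/-- The quadratic form `S ↦ ⟨S²⟩` of the Gibbs state with weight `e^A`. -/
noncomputable def gibbsSquare (A S : Matrix n n ℂ) : ℝ :=
  (S * S * NormedSpace.exp A).trace.re / (NormedSpace.exp A).trace.re

theorem gibbsSquare_nonneg [Nonempty n] (hA : A.IsHermitian) {S : Matrix n n ℂ}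
    (hS : S.IsHermitian) : 0 ≤ gibbsSquare A S := by
  have h := trace_conjTranspose_mul_self_mul_exp_nonneg hA S
  rw [hS.eq] at h
  exact div_nonneg h (trace_exp_re_pos hA).le

/-- Averaging over perturbations of mean zero: the cross terms cancel to first order, so that the
square of `⟨S²⟩`, on the scale `N`, grows at most by a factor `1 + O(1 / N)`. -/
theorem sum_gibbsSquare_add_sq_le [Nonempty n] {ι : Type*} [Fintype ι] (hA : A.IsHermitian)
    {S : Matrix n n ℂ} (hS : S.IsHermitian) {V : ι → Matrix n n ℂ}
    (hV : ∀ j, (V j).IsHermitian) (hsum : ∑ j, V j = 0) {c : ℝ} (hc0 : 0 < c)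
    (hc : ∀ j, ‖V j‖ ≤ c) {N : ℝ} (hN : 1 ≤ N) :
    ∑ j, (gibbsSquare A (S + V j) + N) ^ 2 ≤
      Fintype.card ι * (Real.exp ((10 * c ^ 2 + 2 * c ^ 4) / N) * (gibbsSquare A S + N) ^ 2) := by
  have hZ := trace_exp_re_pos hA
  set Z := (NormedSpace.exp A).trace.re with hZdef
  set b : ι → ℝ := fun j => (S * V j * NormedSpace.exp A).trace.re / Z with hb
  -- `b j` is the real part of `⟨S V_j⟩`, half the first order term of `⟨(S + V_j)²⟩`
  have expand : ∀ (t : ℝ) j, gibbsSquare A (S + (t : ℂ) • V j) =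
      gibbsSquare A S + 2 * t * b j + t ^ 2 * gibbsSquare A (V j) := by
    intro t j
    have e : (S + (t : ℂ) • V j) * (S + (t : ℂ) • V j) * NormedSpace.exp A =
        S * S * NormedSpace.exp A + (t : ℂ) • (S * V j * NormedSpace.exp A)
        + (t : ℂ) • (V j * S * NormedSpace.exp A)
        + ((t ^ 2 : ℝ) : ℂ) • (V j * V j * NormedSpace.exp A) := by
      simp only [Matrix.add_mul, Matrix.mul_add, smul_mul_assoc, mul_smul_comm, pow_two,
        Complex.ofReal_mul, mul_smul, smul_add]
      abel
    simp only [gibbsSquare, hb]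
    rw [e]
    simp only [Matrix.trace_add, Matrix.trace_smul, smul_eq_mul, Complex.add_re,
      Complex.re_ofReal_mul]
    rw [trace_mul_re_comm (hV j) hS _ hA.exp, ← hZdef]
    ring
  have hq : ∀ j, 0 ≤ gibbsSquare A (V j) := fun j => gibbsSquare_nonneg hA (hV j)
  have hqc : ∀ j, gibbsSquare A (V j) ≤ c ^ 2 := fun j => by
    rw [gibbsSquare, div_le_iff₀ hZ]
    exact trace_sq_mul_exp_le hA (hV j) (hc j)
  have hqS := gibbsSquare_nonneg hA hS
  -- the Cauchy–Schwarz inequality, from positivity at the optimal multiple of `V j`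
  have hb2 : ∀ j, b j ^ 2 ≤ gibbsSquare A S * c ^ 2 := by
    intro j
    have hherm : (S + ((-(b j / c ^ 2) : ℝ) : ℂ) • V j).IsHermitian := by
      refine hS.add ?_
      rw [Matrix.IsHermitian, Matrix.conjTranspose_smul, (hV j).eq, Complex.star_def,
        Complex.conj_ofReal]
    have h := gibbsSquare_nonneg hA hherm
    rw [expand] at h
    have h2 : (-(b j / c ^ 2)) ^ 2 * gibbsSquare A (V j) ≤ (-(b j / c ^ 2)) ^ 2 * c ^ 2 := by
      gcongr; exact hqc j
    have h3 : gibbsSquare A S - b j ^ 2 / c ^ 2 ≥ 0 := by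
      have e : (-(b j / c ^ 2)) ^ 2 * c ^ 2 = b j ^ 2 / c ^ 2 := by field_simp
      have e2 : 2 * -(b j / c ^ 2) * b j = -2 * (b j ^ 2 / c ^ 2) := by ring
      rw [e] at h2
      rw [e2] at h
      linarith
    have h4 : b j ^ 2 / c ^ 2 ≤ gibbsSquare A S := by linarith
    rwa [div_le_iff₀ (by positivity)] at h4
  have hbsum : ∑ j, b j = 0 := by
    simp only [hb]
    rw [← Finset.sum_div, ← Complex.re_sum, ← Matrix.trace_sum, ← Finset.sum_mul, ← Finset.mul_sum,
      hsum]
    simp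
  set q := gibbsSquare A S with hqdef
  have hpos : 0 ≤ c ^ 2 := by positivity
  have step : ∀ j, (gibbsSquare A (S + V j) + N) ^ 2 ≤
      (1 + (10 * c ^ 2 + 2 * c ^ 4) / N) * (q + N) ^ 2 + 4 * (q + N) * b j := by
    intro j
    have h := expand 1 j
    rw [Complex.ofReal_one, one_smul] at h
    rw [h]
    have h1 : (q + 2 * 1 * b j + 1 ^ 2 * gibbsSquare A (V j) + N) ^ 2 ≤
        (q + N) ^ 2 + 4 * (q + N) * b j + (2 * (q + N) * c ^ 2 + 8 * (q * c ^ 2) + 2 * c ^ 4) := by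
      have i1 : (gibbsSquare A (V j)) ^ 2 ≤ c ^ 4 := by
        have := pow_le_pow_left₀ (hq j) (hqc j) 2
        calc _ ≤ _ := this
          _ = c ^ 4 := by ring
      have i2 := mul_le_mul_of_nonneg_left (hqc j) (by positivity : (0 : ℝ) ≤ q + N)
      nlinarith [hb2 j, sq_nonneg (2 * b j - gibbsSquare A (V j))]
    have h2 : 2 * (q + N) * c ^ 2 + 8 * (q * c ^ 2) + 2 * c ^ 4 ≤
        (10 * c ^ 2 + 2 * c ^ 4) / N * (q + N) ^ 2 := by
      rw [div_mul_eq_mul_div, le_div_iff₀ (by linarith)]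
      have j1 : (q + N) * N ≤ (q + N) ^ 2 := by nlinarith
      have j2 : q * N ≤ (q + N) ^ 2 := by nlinarith
      have j3 : N ≤ (q + N) ^ 2 := by nlinarith
      nlinarith [mul_le_mul_of_nonneg_left j1 hpos, mul_le_mul_of_nonneg_left j2 hpos,
        mul_le_mul_of_nonneg_left j3 (by positivity : (0 : ℝ) ≤ c ^ 4)]
    linarith
  have h := Finset.sum_le_sum fun j (_ : j ∈ Finset.univ) => step j
  rw [Finset.sum_add_distrib, ← Finset.mul_sum (s := Finset.univ) (f := b), hbsum, mul_zero,
    add_zero, Finset.sum_const, Finset.card_univ, nsmul_eq_mul] at h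
  refine h.trans ?_
  gcongr
  linarith [Real.add_one_le_exp ((10 * c ^ 2 + 2 * c ^ 4) / N)]

omit [Fintype n] [DecidableEq n] in
theorem isHermitian_ofReal_smul {M : Matrix n n ℂ} (hM : M.IsHermitian) (r : ℝ) :
    ((r : ℂ) • M).IsHermitian := by
  rw [Matrix.IsHermitian, Matrix.conjTranspose_smul, hM.eq, Complex.star_def, Complex.conj_ofReal]

theorem continuous_trace_re_mul_exp {X : Type*} [TopologicalSpace X] {M K : X → Matrix n n ℂ}
    (hM : Continuous M) (hK : Continuous K) :
    Continuous fun x => (M x * NormedSpace.exp (K x)).trace.re := by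
  let _ : NormedAlgebra ℚ (Matrix n n ℂ) := .restrictScalars ℚ ℂ _
  have h : Continuous fun x => M x * NormedSpace.exp (K x) :=
    hM.mul (NormedSpace.exp_continuous.comp hK)
  exact Complex.continuous_re.comp h.matrix_trace

theorem continuous_trace_re_exp {X : Type*} [TopologicalSpace X] {K : X → Matrix n n ℂ}
    (hK : Continuous K) :
    Continuous fun x => (NormedSpace.exp (K x)).trace.re := by
  simpa using continuous_trace_re_mul_exp (M := fun _ => 1) continuous_const hK

theorem continuous_gibbsSquare {X : Type*} [TopologicalSpace X] [Nonempty n]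
    {M K : X → Matrix n n ℂ} (hM : Continuous M) (hK : Continuous K)
    (hKh : ∀ x, (K x).IsHermitian) :
    Continuous fun x => gibbsSquare (K x) (M x) :=
  (continuous_trace_re_mul_exp (hM.mul hM) hK).div (continuous_trace_re_exp hK)
    fun x => (trace_exp_re_pos (hKh x)).ne'

end TraceInequalities

/-! ### Gauge covariance of the fermion model -/

section Fermions

variable {d : ℕ} {Λ : Finset (Site d)}

theorem num_eq_diagonal (m : Mode Λ) :
    num m = Matrix.diagonal fun S => if m ∈ S then (1 : ℂ) else 0 := by
  ext S T
  rw [num, create, Matrix.mul_apply, Matrix.diagonal_apply]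
  simp only [Matrix.conjTranspose_apply, annih, Matrix.of_apply]
  by_cases hS : m ∈ S
  · rw [Finset.sum_eq_single (S.erase m)]
    · by_cases hST : S = T
      · subst hST
        simp [hS, ← pow_add, ← two_mul]
      · have : ¬ (m ∈ T ∧ S.erase m = T.erase m) := by
          rintro ⟨hT, h⟩
          exact hST (by rw [← Finset.insert_erase hS, h, Finset.insert_erase hT])
        simp [hST, this]
    · intro R _ hR
      simp [hR]
    · simp
  · simp [hS]

theorem isHermitian_num (m : Mode Λ) : (num m).IsHermitian := by
  rw [num, create]
  exact Matrix.isHermitian_conjTranspose_mul_self _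

theorem norm_annih_le (m : Mode Λ) : ‖annih m‖ ≤ 1 := by
  have h : ‖annih m‖ * ‖annih m‖ ≤ 1 := by
    rw [← Matrix.l2_opNorm_conjTranspose_mul_self]
    change ‖num m‖ ≤ 1
    rw [num_eq_diagonal, Matrix.l2_opNorm_diagonal, pi_norm_le_iff_of_nonneg zero_le_one]
    intro S
    split_ifs <;> simp
  nlinarith [norm_nonneg (annih m)]

theorem norm_create_le (m : Mode Λ) : ‖create m‖ ≤ 1 := by
  rw [create, Matrix.l2_opNorm_conjTranspose]
  exact norm_annih_le m

/-- The phase `e^{iθ}` of an angle. -/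
noncomputable def phase (a : Angle) : ℂ := (a.toCircle : ℂ)

theorem phase_add (a b : Angle) : phase (a + b) = phase a * phase b := by
  simp [phase, AddCircle.toCircle_add]

theorem phase_neg (a : Angle) : phase (-a) = star (phase a) := by
  rw [phase, AddCircle.toCircle_neg, Circle.coe_inv_eq_conj]; rfl

theorem phase_zero : phase 0 = 1 := by simp [phase]

theorem norm_phase (a : Angle) : ‖phase a‖ = 1 := Circle.norm_coe _

theorem star_phase_mul (a : Angle) : star (phase a) * phase a = 1 := by
  rw [← phase_neg, ← phase_add, neg_add_cancel, phase_zero]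

theorem continuous_phase : Continuous phase :=
  Continuous.comp continuous_subtype_val AddCircle.continuous_toCircle

/-- The diagonal unitary `exp (i ∑_x θ_x n_x)` implementing a gauge transformation. -/
noncomputable def gaugeUnitary (Λ : Finset (Site d)) (θ : Site d → Angle) :
    unitary (FockOp Λ) :=
  ⟨Matrix.diagonal fun S => ∏ m ∈ S, phase (θ m.1.1), by
    have h : ∀ S : Finset (Mode Λ),
        star (∏ m ∈ S, phase (θ m.1.1)) * ∏ m ∈ S, phase (θ m.1.1) = 1 := by
      intro S
      rw [star_prod, ← Finset.prod_mul_distrib]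
      exact Finset.prod_eq_one fun m _ => star_phase_mul _
    rw [Unitary.mem_iff, Matrix.star_eq_conjTranspose, Matrix.diagonal_conjTranspose,
      Matrix.diagonal_mul_diagonal, Matrix.diagonal_mul_diagonal, ← Matrix.diagonal_one]
    constructor <;> congr 1 <;> ext S
    · exact h S
    · rw [mul_comm]; exact h S⟩

/-- Conjugation of observables by the gauge transformation `θ`. -/
noncomputable def gaugeAut (Λ : Finset (Site d)) (θ : Site d → Angle) : FockOp Λ ≃⋆ₐ[ℂ] FockOp Λ :=
  Unitary.conjStarAlgAut ℂ (FockOp Λ) (gaugeUnitary Λ θ)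

theorem gaugeAut_apply (θ : Site d → Angle) (M : FockOp Λ) :
    gaugeAut Λ θ M = (gaugeUnitary Λ θ : FockOp Λ) * M * star (gaugeUnitary Λ θ : FockOp Λ) :=
  Unitary.conjStarAlgAut_apply _ _

theorem trace_gaugeAut (θ : Site d → Angle) (M : FockOp Λ) :
    (gaugeAut Λ θ M).trace = M.trace := by
  rw [gaugeAut_apply, Matrix.trace_mul_comm, ← mul_assoc, Unitary.coe_star_mul_self, one_mul]

theorem gaugeAut_exp (θ : Site d → Angle) (M : FockOp Λ) :
    gaugeAut Λ θ (NormedSpace.exp M) = NormedSpace.exp (gaugeAut Λ θ M) := by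
  have hinv : star (gaugeUnitary Λ θ : FockOp Λ) = (gaugeUnitary Λ θ : FockOp Λ)⁻¹ :=
    (Matrix.inv_eq_left_inv (Unitary.coe_star_mul_self _)).symm
  have hu : IsUnit (gaugeUnitary Λ θ : FockOp Λ) := (Unitary.toUnits (gaugeUnitary Λ θ)).isUnit
  rw [gaugeAut_apply, gaugeAut_apply, hinv, Matrix.exp_conj _ _ hu]

theorem gaugeAut_annih (θ : Site d → Angle) (m : Mode Λ) :
    gaugeAut Λ θ (annih m) = star (phase (θ m.1.1)) • annih m := by
  have h : (gaugeUnitary Λ θ : FockOp Λ) * annih m =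
      (star (phase (θ m.1.1)) • annih m) * (gaugeUnitary Λ θ : FockOp Λ) := by
    ext S' S
    simp only [gaugeUnitary]
    rw [Matrix.diagonal_mul, Matrix.mul_diagonal, Matrix.smul_apply]
    simp only [annih, Matrix.of_apply]
    split_ifs with hc
    · obtain ⟨hm, rfl⟩ := hc
      rw [← Finset.mul_prod_erase S _ hm, smul_eq_mul]
      linear_combination (-(∏ m ∈ S.erase m, phase (θ m.1.1)) *
        (-1) ^ (S.filter fun j => modeKey j < modeKey m).card) * star_phase_mul (θ m.1.1)
    · simp
  rw [gaugeAut_apply, h, mul_assoc, Unitary.mul_star_self_of_mem (gaugeUnitary Λ θ).2, mul_one]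

theorem gaugeAut_create (θ : Site d → Angle) (m : Mode Λ) :
    gaugeAut Λ θ (create m) = phase (θ m.1.1) • create m := by
  rw [create, ← Matrix.star_eq_conjTranspose, map_star, gaugeAut_annih, star_smul, star_star]

theorem gaugeAut_num (θ : Site d → Angle) (m : Mode Λ) : gaugeAut Λ θ (num m) = num m := by
  rw [num, map_mul, gaugeAut_create, gaugeAut_annih, smul_mul_smul_comm, mul_comm,
    star_phase_mul, one_smul]

/-- The pure gauge field of a gauge function `θ`, with `A_{x,y} = θ_y - θ_x`. -/
noncomputable def pureGauge (θ : Site d → Angle) : GaugeField d :=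
  fun b => θ (b.1 + unitVec b.2) - θ b.1

theorem link_add (A B : GaugeField d) (x y : Site d) :
    link (A + B) x y = link A x y + link B x y := by
  rw [link, link, link, ← Finset.sum_add_distrib]
  refine Finset.sum_congr rfl fun i _ => ?_
  split_ifs <;> simp [add_comm]

theorem link_swap (A : GaugeField d) (x y : Site d) : link A y x = -link A x y := by
  rw [link, link, ← Finset.sum_neg_distrib]
  refine Finset.sum_congr rfl fun i _ => ?_
  by_cases h1 : x = y + unitVec i
  · have h2 : ¬ y = x + unitVec i := by
      intro h2
      have h3 := congrFun h1 i
      have h4 := congrFun h2 i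
      simp [unitVec] at h3 h4
      omega
    rw [if_pos h1, if_neg h2, if_pos h1, neg_neg]
  · rw [if_neg h1, if_neg h1]
    split_ifs <;> simp

theorem natAbs_sub_le_latticeDist (x y : Site d) (i : Fin d) :
    (x i - y i).natAbs ≤ latticeDist x y :=
  Finset.single_le_sum (f := fun i => (x i - y i).natAbs) (fun _ _ => Nat.zero_le _)
    (Finset.mem_univ i)

/-- Nearest neighbours are joined by a bond in exactly one direction. -/
theorem exists_unitVec_of_latticeDist_eq_one {x y : Site d} (h : latticeDist x y = 1) :
    ∃ i, (y = x + unitVec i ∨ x = y + unitVec i) ∧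
      ∀ j, j ≠ i → ¬ (y = x + unitVec j ∨ x = y + unitVec j) := by
  obtain ⟨i, hi⟩ : ∃ i, (x i - y i).natAbs ≠ 0 := by
    by_contra! hc
    rw [latticeDist, Finset.sum_eq_zero fun i _ => hc i] at h
    exact zero_ne_one h
  have hsplit := Finset.add_sum_erase Finset.univ (fun i => (x i - y i).natAbs) (Finset.mem_univ i)
  change _ = latticeDist x y at hsplit
  rw [h] at hsplit
  have hi1 : (x i - y i).natAbs = 1 := by omega
  have hrest : ∑ j ∈ Finset.univ.erase i, (x j - y j).natAbs = 0 := by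
    omega
  have hj : ∀ j, j ≠ i → x j = y j := by
    intro j hj
    have := Finset.sum_eq_zero_iff.mp hrest j (by simp [hj])
    omega
  refine ⟨i, ?_, ?_⟩
  · rcases Int.natAbs_eq (x i - y i) with h1 | h1
    · right
      ext j
      by_cases hji : j = i
      · subst hji; simp [unitVec]; omega
      · simp [unitVec, hji, hj j hji]
    · left
      ext j
      by_cases hji : j = i
      · subst hji; simp [unitVec]; omega
      · simp [unitVec, hji, hj j hji]
  · rintro j hji (h1 | h1)
    · have := congrFun h1 j
      simp [unitVec, hj j hji] at this
    · have := congrFun h1 j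
      simp [unitVec, hj j hji] at this

theorem link_pureGauge (θ : Site d → Angle) {x y : Site d} (h : latticeDist x y = 1) :
    link (pureGauge θ) x y = θ y - θ x := by
  obtain ⟨i, hi, hj⟩ := exists_unitVec_of_latticeDist_eq_one h
  rw [link, Finset.sum_eq_single i]
  · split_ifs with h1 h2
    · rw [pureGauge, ← h1]
    · rw [pureGauge, ← h2, neg_sub]
    · tauto
  · intro j _ hji
    have := hj j hji
    push Not at this
    rw [if_neg this.1, if_neg this.2]
  · simp

/-- The Cooper pair operator on the sites `a, b`, with complex phase `w`. -/
noncomputable def pairTerm (w : ℂ) (a b : {x // x ∈ Λ}) : FockOp Λ :=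
  star w • (annih (a, up) * annih (b, down)) + w • (create (b, down) * create (a, up))

theorem pairTerm_sum {ι : Type*} (s : Finset ι) (w : ι → ℂ) (a b : {x // x ∈ Λ}) :
    ∑ j ∈ s, pairTerm (w j) a b = pairTerm (∑ j ∈ s, w j) a b := by
  simp only [pairTerm, Finset.sum_add_distrib, star_sum, Finset.sum_smul]

theorem pairTerm_zero (a b : {x // x ∈ Λ}) : pairTerm 0 a b = 0 := by simp [pairTerm]

theorem isHermitian_pairTerm (w : ℂ) (a b : {x // x ∈ Λ}) : (pairTerm w a b).IsHermitian := by
  rw [Matrix.IsHermitian, pairTerm, Matrix.conjTranspose_add, Matrix.conjTranspose_smul,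
    Matrix.conjTranspose_smul, Matrix.conjTranspose_mul, Matrix.conjTranspose_mul, create, create,
    Matrix.conjTranspose_conjTranspose, Matrix.conjTranspose_conjTranspose, star_star, add_comm]

theorem norm_pairTerm_le {w : ℂ} (hw : ‖w‖ ≤ 1) (a b : {x // x ∈ Λ}) : ‖pairTerm w a b‖ ≤ 2 := by
  have h1 : ‖annih (a, up) * annih (b, down)‖ ≤ 1 :=
    (norm_mul_le _ _).trans (mul_le_one₀ (norm_annih_le _) (norm_nonneg _) (norm_annih_le _))
  have h2 : ‖create (b, down) * create (a, up)‖ ≤ 1 :=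
    (norm_mul_le _ _).trans (mul_le_one₀ (norm_create_le _) (norm_nonneg _) (norm_create_le _))
  have h3 := norm_add_le (star w • (annih (a, up) * annih (b, down)))
    (w • (create (b, down) * create (a, up)))
  rw [norm_smul, norm_smul, norm_star] at h3
  have h4 := mul_le_one₀ hw (norm_nonneg _) h1
  have h5 := mul_le_one₀ hw (norm_nonneg _) h2
  rw [pairTerm]
  linarith

end Fermions

namespace Model

variable {d : ℕ} (model : Model d) (Λ : Finset (Site d))

theorem gaugeAut_hopping (A : GaugeField d) (θ : Site d → Angle) :
    gaugeAut Λ θ (model.hopping Λ (A + pureGauge θ)) = model.hopping Λ A := by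
  simp only [hopping, map_sum, map_smul, map_mul, gaugeAut_create, gaugeAut_annih]
  refine Finset.sum_congr rfl fun x _ => Finset.sum_congr rfl fun y _ =>
    Finset.sum_congr rfl fun α _ => Finset.sum_congr rfl fun γ _ => ?_
  rw [smul_mul_smul_comm, smul_smul]
  by_cases ht : model.t x.1 y.1 α γ = 0
  · simp [ht]
  · have h := model.t_nearest _ _ _ _ ht
    change (_ * phase _ * _) • _ = (_ * phase _) • _
    rw [link_add, link_pureGauge θ h, phase_add, sub_eq_add_neg, phase_add, phase_neg]
    congr 1
    linear_combination (model.t x.1 y.1 α γ * phase (link A x.1 y.1)) *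
      (star_phase_mul (θ x.1) * (star (phase (θ y.1)) * phase (θ y.1)) + star_phase_mul (θ y.1))

theorem gaugeAut_interaction (θ : Site d → Angle) :
    gaugeAut Λ θ (model.interaction Λ) = model.interaction Λ := by
  simp only [interaction, map_sum, map_smul, map_list_prod, List.map_ofFn]
  refine Finset.sum_congr rfl fun I _ => Finset.sum_congr rfl fun w _ => ?_
  congr 3
  ext k
  simp [gaugeAut_num]

/-- The part of the gauge rotated pairing operator coming from pairs of sites in `T`. -/
noncomputable def pairingOn (T : Finset (Site d)) (θ : Site d → Angle) : FockOp Λ :=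
  ∑ a : {x // x ∈ Λ}, ∑ b : {x // x ∈ Λ},
    if b.1 ∈ model.nbhd a.1 ∧ a.1 ∈ T ∧ b.1 ∈ T then
      pairTerm (phase (θ a.1) * phase (θ b.1)) a b else 0

theorem pairingOn_zero : model.pairingOn Λ Λ 0 = model.pairing Λ := by
  simp only [pairingOn, pairing]
  refine Finset.sum_congr rfl fun x _ => Finset.sum_congr rfl fun y _ => ?_
  simp [x.2, y.2, pairTerm, phase_zero]

theorem gaugeAut_pairing (θ : Site d → Angle) :
    gaugeAut Λ θ (model.pairing Λ) = model.pairingOn Λ Λ θ := by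
  simp only [pairing, pairingOn, map_sum]
  refine Finset.sum_congr rfl fun x _ => Finset.sum_congr rfl fun y _ => ?_
  by_cases h : y.1 ∈ model.nbhd x.1
  · simp only [h, x.2, y.2, and_self, if_true, map_add, map_mul, gaugeAut_annih, gaugeAut_create,
      pairTerm, smul_mul_smul_comm, star_mul']
    rw [mul_comm (phase (θ y.1))]
  · simp [h]

theorem isHermitian_pairingOn (T : Finset (Site d)) (θ : Site d → Angle) :
    (model.pairingOn Λ T θ).IsHermitian := by
  unfold pairingOn Matrix.IsHermitian
  simp only [Matrix.conjTranspose_sum]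
  refine Finset.sum_congr rfl fun a _ => Finset.sum_congr rfl fun b _ => ?_
  split_ifs
  · exact isHermitian_pairTerm _ _ _
  · exact Matrix.conjTranspose_zero

theorem isHermitian_pairing : (model.pairing Λ).IsHermitian := by
  rw [← pairingOn_zero]
  exact model.isHermitian_pairingOn Λ Λ 0

theorem isHermitian_hopping (A : GaugeField d) : (model.hopping Λ A).IsHermitian := by
  unfold hopping Matrix.IsHermitian
  simp only [Matrix.conjTranspose_sum, Matrix.conjTranspose_smul, Matrix.conjTranspose_mul]
  rw [Finset.sum_comm]
  refine Finset.sum_congr rfl fun x _ => Finset.sum_congr rfl fun y _ => ?_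
  rw [Finset.sum_comm]
  refine Finset.sum_congr rfl fun α _ => Finset.sum_congr rfl fun γ _ => ?_
  change star (_ * phase _) • _ = (_ * phase _) • _
  rw [star_mul', ← phase_neg, link_swap, neg_neg, model.t_hermitian x.1 y.1 α γ, create, create,
    Matrix.conjTranspose_conjTranspose, Complex.star_def, Complex.conj_conj]

theorem isHermitian_interaction : (model.interaction Λ).IsHermitian := by
  have hprod : ∀ l : List (Mode Λ), ∃ v : Finset (Mode Λ) → ℝ,
      (l.map num).prod = Matrix.diagonal fun S => (v S : ℂ) := by
    intro l
    induction l with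
    | nil => exact ⟨fun _ => 1, by simp⟩
    | cons m l ih =>
      obtain ⟨v, hv⟩ := ih
      refine ⟨fun S => (if m ∈ S then 1 else 0) * v S, ?_⟩
      rw [List.map_cons, List.prod_cons, hv, num_eq_diagonal, Matrix.diagonal_mul_diagonal]
      congr 1
      ext S
      by_cases hm : m ∈ S <;> simp [hm]
  unfold interaction Matrix.IsHermitian
  simp only [Matrix.conjTranspose_sum, Matrix.conjTranspose_smul]
  refine Finset.sum_congr rfl fun I _ => Finset.sum_congr rfl fun w _ => ?_
  obtain ⟨v, hv⟩ := hprod (List.ofFn w)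
  rw [List.map_ofFn] at hv
  change (List.ofFn fun k => num (w k)).prod = _ at hv
  rw [hv, Matrix.diagonal_conjTranspose, Complex.star_def, Complex.conj_ofReal]
  congr 2
  ext S
  simp

theorem isHermitian_hamiltonian (h : ℝ) (A : GaugeField d) :
    (model.hamiltonian Λ h A).IsHermitian := by
  have hN : (∑ m : Mode Λ, num m).IsHermitian := by
    unfold Matrix.IsHermitian
    rw [Matrix.conjTranspose_sum]
    exact Finset.sum_congr rfl fun m _ => isHermitian_num m
  exact (((model.isHermitian_hopping Λ A).add (model.isHermitian_interaction Λ)).sub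
    (isHermitian_ofReal_smul hN _)).sub (isHermitian_ofReal_smul (model.isHermitian_pairing Λ) _)

theorem hamiltonian_eq (h : ℝ) (A : GaugeField d) :
    model.hamiltonian Λ h A = model.hamiltonian Λ 0 A - (h : ℂ) • model.pairing Λ := by
  simp [hamiltonian]

/-- Gauge covariance: the gauge transformation removes a pure gauge part of the field from the
hopping term and moves it into the phases of the pairing field. -/
theorem gaugeAut_hamiltonian (h : ℝ) (A : GaugeField d) (θ : Site d → Angle) :
    gaugeAut Λ θ (model.hamiltonian Λ h (A + pureGauge θ)) =
      model.hamiltonian Λ 0 A - (h : ℂ) • model.pairingOn Λ Λ θ := by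
  simp only [hamiltonian, map_sub, map_add, map_smul, map_sum, gaugeAut_num, gaugeAut_hopping,
    gaugeAut_interaction, gaugeAut_pairing]
  simp

/-- The exponent `-β (H - μ N - h H_ext)` of the Boltzmann operator. -/
noncomputable def exponent (β h : ℝ) (A : GaugeField d) : FockOp Λ :=
  (-β : ℂ) • model.hamiltonian Λ h A

theorem isHermitian_exponent (β h : ℝ) (A : GaugeField d) :
    (model.exponent Λ β h A).IsHermitian := by
  rw [exponent, ← Complex.ofReal_neg]
  exact isHermitian_ofReal_smul (model.isHermitian_hamiltonian Λ h A) _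

theorem exponent_add (β h s : ℝ) (A : GaugeField d) :
    model.exponent Λ β (h + s) A =
      model.exponent Λ β h A + ((β * s : ℝ) : ℂ) • model.pairing Λ := by
  rw [exponent, exponent, hamiltonian_eq, model.hamiltonian_eq Λ h]
  push_cast
  module

theorem gaugeAut_exponent (β h : ℝ) (A : GaugeField d) (θ : Site d → Angle) :
    gaugeAut Λ θ (model.exponent Λ β h (A + pureGauge θ)) =
      model.exponent Λ β 0 A + ((β * h : ℝ) : ℂ) • model.pairingOn Λ Λ θ := by
  rw [exponent, map_smul, gaugeAut_hamiltonian, exponent]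
  push_cast
  module

/-- The angle `π / 2`, whose phase is `i`. -/
noncomputable def quarterTurn : Angle := ((Real.pi / 2 : ℝ) : Angle)

theorem phase_nsmul_quarterTurn (j : ℕ) : phase (j • quarterTurn) = Complex.I ^ j := by
  have h : phase quarterTurn = Complex.I := by
    have e : 2 * Real.pi / (2 * Real.pi) * (Real.pi / 2) = Real.pi / 2 := by
      field_simp
    rw [phase, quarterTurn, AddCircle.toCircle_apply_mk, Circle.coe_exp, e]
    push_cast
    exact Complex.exp_pi_div_two_mul_I
  rw [phase, AddCircle.toCircle_nsmul, Circle.coe_pow]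
  exact congrArg (· ^ j) h

/-- The gauge functions obtained from `θ` by rotations at the site `x` by multiples of `π / 2`.
Four rotations are used because `∑_j w^j = 0` is needed for `w = i` and also for `w = i² = -1`: a
pair with both electrons at `x` has charge two there. -/
noncomputable def rotate (θ : Site d → Angle) (x : Site d) (j : Fin 4) : Site d → Angle :=
  θ + Pi.single x ((j : ℕ) • quarterTurn)

/-- Twice the number of the pairs in `Λ` that contain a given site is at most `c`; this bounds the norm
of their contribution to the pairing operator. -/
def IsPairBound (c : ℝ) : Prop :=
  ∀ (Λ : Finset (Site d)) (x : Site d), (∑ a : {x // x ∈ Λ}, ∑ b : {x // x ∈ Λ},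
    if b.1 ∈ model.nbhd a.1 ∧ (a.1 = x ∨ b.1 = x) then (2 : ℝ) else 0) ≤ c

theorem exists_isPairBound : ∃ c : ℝ, 0 < c ∧ model.IsPairBound c := by
  obtain ⟨r, hr⟩ := model.nbhd_range
  set k : ℝ := ((Finset.Icc (fun _ : Fin d => -(r : ℤ)) (fun _ => (r : ℤ))).card : ℝ) with hk
  -- at most `k` pairs `(x, b)` and at most `k` pairs `(a, x)`; the summand `1` keeps the bound
  -- positive
  refine ⟨4 * k + 1, by positivity, fun Λ x => ?_⟩
  have hball : ∀ p : {x // x ∈ Λ} → Prop, [DecidablePred p] →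
      (∀ a, p a → ∀ i, (a.1 i - x i).natAbs ≤ r) → (∑ a, if p a then (2 : ℝ) else 0) ≤ 2 * k := by
    intro p _ hp
    rw [← Finset.sum_filter, Finset.sum_const, nsmul_eq_mul, mul_comm]
    refine mul_le_mul_of_nonneg_left ?_ zero_le_two
    rw [hk, Nat.cast_le]
    refine Finset.card_le_card_of_injOn (fun a => a.1 - x) ?_ ?_
    · intro a ha
      have h1 := hp a (by simpa using ha)
      simp only [Finset.coe_Icc, Set.mem_Icc, Pi.le_def, Pi.sub_apply]
      constructor <;> intro i <;> have := h1 i <;> omega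
    · intro a _ b _ hab
      exact Subtype.ext (sub_left_injective hab)
  have hsplit : ∀ a b : {x // x ∈ Λ},
      (if b.1 ∈ model.nbhd a.1 ∧ (a.1 = x ∨ b.1 = x) then (2 : ℝ) else 0) ≤
        (if a.1 = x then (if b.1 ∈ model.nbhd x then (2 : ℝ) else 0) else 0) +
        (if b.1 = x then (if x ∈ model.nbhd a.1 then (2 : ℝ) else 0) else 0) := by
    intro a b
    by_cases ha : a.1 = x <;> by_cases hb : b.1 = x <;> simp [ha, hb]
    all_goals split_ifs <;> norm_num
  have hone : ∀ (v : ℝ), 0 ≤ v → (∑ a : {x // x ∈ Λ}, if a.1 = x then v else 0) ≤ v := by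
    intro v hv
    rw [← Finset.sum_filter, Finset.sum_const, nsmul_eq_mul]
    have : (Finset.univ.filter fun a : {x // x ∈ Λ} => a.1 = x).card ≤ 1 := by
      rw [Finset.card_le_one]
      intro a ha b hb
      simp only [Finset.mem_filter, Finset.mem_univ, true_and] at ha hb
      exact Subtype.ext (ha.trans hb.symm)
    have h' : ((Finset.univ.filter fun a : {x // x ∈ Λ} => a.1 = x).card : ℝ) ≤ 1 := by
      exact_mod_cast this
    nlinarith
  have h1 : (∑ b : {x // x ∈ Λ}, if b.1 ∈ model.nbhd x then (2 : ℝ) else 0) ≤ 2 * k := by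
    apply hball
    intro b hb i
    have := natAbs_sub_le_latticeDist x b.1 i
    have := hr x b.1 hb
    omega
  have h2 : (∑ a : {x // x ∈ Λ}, if x ∈ model.nbhd a.1 then (2 : ℝ) else 0) ≤ 2 * k := by
    apply hball
    intro a ha i
    have := natAbs_sub_le_latticeDist a.1 x i
    have := hr a.1 x ha
    omega
  calc _ ≤ ∑ a : {x // x ∈ Λ}, ∑ b : {x // x ∈ Λ},
        ((if a.1 = x then (if b.1 ∈ model.nbhd x then (2 : ℝ) else 0) else 0) +
        (if b.1 = x then (if x ∈ model.nbhd a.1 then (2 : ℝ) else 0) else 0)) :=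
        Finset.sum_le_sum fun a _ => Finset.sum_le_sum fun b _ => hsplit a b
    _ = (∑ b : {x // x ∈ Λ}, ∑ a : {x // x ∈ Λ},
          if a.1 = x then (if b.1 ∈ model.nbhd x then (2 : ℝ) else 0) else 0) +
        ∑ a : {x // x ∈ Λ}, ∑ b : {x // x ∈ Λ},
          if b.1 = x then (if x ∈ model.nbhd a.1 then (2 : ℝ) else 0) else 0 := by
        simp only [Finset.sum_add_distrib]
        rw [Finset.sum_comm]
    _ ≤ (∑ b : {x // x ∈ Λ}, if b.1 ∈ model.nbhd x then (2 : ℝ) else 0) +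
        ∑ a : {x // x ∈ Λ}, if x ∈ model.nbhd a.1 then (2 : ℝ) else 0 := by
        refine add_le_add (Finset.sum_le_sum fun b _ => hone _ ?_)
          (Finset.sum_le_sum fun a _ => hone _ ?_) <;> split_ifs <;> norm_num
    _ ≤ 4 * k + 1 := by linarith

/-- Adding a site `x` to `T` adds a perturbation of bounded norm to the pairing operator. Its pairs
carry charge `1` or `2` at `x`, so that it averages to zero over the four rotations at `x`. -/
theorem exists_pairingOn_insert {c : ℝ} (hc : model.IsPairBound c)
    {T : Finset (Site d)} {x : Site d} (hx : x ∉ T) (θ : Site d → Angle) :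
    ∃ V : Fin 4 → FockOp Λ, (∀ j, (V j).IsHermitian) ∧ ∑ j, V j = 0 ∧ (∀ j, ‖V j‖ ≤ c) ∧
      ∀ j, model.pairingOn Λ (insert x T) (rotate θ x j) = model.pairingOn Λ T θ + V j := by
  have hsame : ∀ j y, y ≠ x → rotate θ x j y = θ y := by
    intro j y hy; simp [rotate, hy]
  have hat : ∀ j, phase (rotate θ x j x) = phase (θ x) * Complex.I ^ (j : ℕ) := by
    intro j; simp [rotate, phase_add, phase_nsmul_quarterTurn]
  have hI : ∑ j : Fin 4, Complex.I ^ (j : ℕ) = 0 := by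
    simp [Fin.sum_univ_four, Complex.I_pow_three]
  have hI2 : ∑ j : Fin 4, Complex.I ^ (j : ℕ) * Complex.I ^ (j : ℕ) = 0 := by
    simp [Fin.sum_univ_four, Complex.I_pow_three]
  have key : ∀ j, model.pairingOn Λ (insert x T) (rotate θ x j) - model.pairingOn Λ T θ =
      ∑ a : {x // x ∈ Λ}, ∑ b : {x // x ∈ Λ},
        if (b.1 ∈ model.nbhd a.1 ∧ (a.1 = x ∨ b.1 = x)) ∧ a.1 ∈ insert x T ∧ b.1 ∈ insert x T then
          pairTerm (phase (rotate θ x j a.1) * phase (rotate θ x j b.1)) a b else 0 := by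
    intro j
    rw [pairingOn, pairingOn, ← Finset.sum_sub_distrib]
    refine Finset.sum_congr rfl fun a _ => ?_
    rw [← Finset.sum_sub_distrib]
    refine Finset.sum_congr rfl fun b _ => ?_
    by_cases ha : a.1 = x <;> by_cases hb : b.1 = x
    · simp [ha, hb, hx]
    · simp [ha, hb, hx]
    · simp [ha, hb, hx]
    · simp [ha, hb, hsame]
  refine ⟨fun j => model.pairingOn Λ (insert x T) (rotate θ x j) - model.pairingOn Λ T θ,
    fun j => (model.isHermitian_pairingOn _ _ _).sub (model.isHermitian_pairingOn _ _ _),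
    ?_, fun j => ?_, fun j => (add_sub_cancel _ _).symm⟩
  · simp only [key]
    rw [Finset.sum_comm]
    refine Finset.sum_eq_zero fun a _ => ?_
    rw [Finset.sum_comm]
    refine Finset.sum_eq_zero fun b _ => ?_
    split_ifs with h
    · rw [pairTerm_sum]
      have hz : ∑ j : Fin 4, phase (rotate θ x j a.1) * phase (rotate θ x j b.1) = 0 := by
        by_cases ha : a.1 = x <;> by_cases hb : b.1 = x
        · simp only [ha, hb, hat]
          calc _ = ∑ j : Fin 4, (phase (θ x) * phase (θ x)) *
                (Complex.I ^ (j : ℕ) * Complex.I ^ (j : ℕ)) :=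
                Finset.sum_congr rfl fun j _ => by ring
            _ = 0 := by rw [← Finset.mul_sum, hI2, mul_zero]
        · simp only [ha, hat, hsame _ _ hb]
          rw [← Finset.sum_mul, ← Finset.mul_sum, hI, mul_zero, zero_mul]
        · simp only [hb, hat, hsame _ _ ha]
          rw [← Finset.mul_sum, ← Finset.mul_sum, hI, mul_zero, mul_zero]
        · exact absurd h.1.2 (by tauto)
      rw [hz, pairTerm_zero]
    · simp
  · beta_reduce
    rw [key]
    refine le_trans ?_ (hc Λ x)
    refine (norm_sum_le _ _).trans (Finset.sum_le_sum fun a _ => ?_)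
    refine (norm_sum_le _ _).trans (Finset.sum_le_sum fun b _ => ?_)
    split_ifs with h1 h2 h2
    · exact norm_pairTerm_le (by rw [norm_mul, norm_phase, norm_phase, mul_one]) a b
    · exact absurd h1.1 h2
    · simp
    · simp

end Model

/-! ### Averages over gauge transformations -/

section Averages

variable {d : ℕ}

/-- The Haar probability measure of a compact abelian group. -/
noncomputable def haarProb (G : Type*) [AddCommGroup G] [TopologicalSpace G]
    [IsTopologicalAddGroup G] [CompactSpace G] [MeasurableSpace G] [BorelSpace G] : Measure G :=
  Measure.addHaarMeasure ⊤

section HaarProb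

variable (G : Type*) [AddCommGroup G] [TopologicalSpace G] [IsTopologicalAddGroup G]
  [CompactSpace G] [MeasurableSpace G] [BorelSpace G]

instance isProbabilityMeasure_haarProb : IsProbabilityMeasure (haarProb G) :=
  ⟨by simpa [haarProb] using
    Measure.addHaarMeasure_self (K₀ := (⊤ : TopologicalSpace.PositiveCompacts G))⟩

instance isAddLeftInvariant_haarProb : (haarProb G).IsAddLeftInvariant := by
  unfold haarProb; infer_instance

end HaarProb

/-- The distribution of a gauge function whose values `θ_x` are independent and uniformly
distributed. It is the Haar measure, so that the invariance under rotations at a single site is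
immediate. -/
noncomputable abbrev gaugeHaar (d : ℕ) : Measure (Site d → Angle) := haarProb (Site d → Angle)

theorem integrable_of_continuous_of_compactSpace {X : Type*} [TopologicalSpace X] [CompactSpace X]
    [MeasurableSpace X] [OpensMeasurableSpace X] {μ : Measure X} [IsFiniteMeasure μ] {f : X → ℝ}
    (hf : Continuous f) : Integrable f μ :=
  hf.integrable_of_hasCompactSupport (HasCompactSupport.of_compactSpace f)

/-- Integration over the gauge functions, one site at a time: a bound for the average over four
rotations at a single site suffices, because the Haar measure is invariant under these. -/
theorem integral_le_of_sum_rotate_le {Φ : Finset (Site d) → (Site d → Angle) → ℝ}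
    (hΦ : ∀ T, Continuous (Φ T)) {K : ℝ} (hK : 0 ≤ K)
    (hstep : ∀ T x, x ∉ T → ∀ θ,
      ∑ j : Fin 4, Φ (insert x T) (Model.rotate θ x j) ≤ 4 * (K * Φ T θ))
    (T : Finset (Site d)) :
    ∫ θ, Φ T θ ∂(gaugeHaar d) ≤ K ^ T.card * ∫ θ, Φ ∅ θ ∂(gaugeHaar d) := by
  induction T using Finset.induction_on with
  | empty => simp
  | insert x T hx ih =>
    have hint : ∀ j : Fin 4,
        Integrable (fun θ => Φ (insert x T) (Model.rotate θ x j)) (gaugeHaar d) := fun j =>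
      integrable_of_continuous_of_compactSpace
        ((hΦ _).comp (by unfold Model.rotate; fun_prop))
    have h1 : ∀ j : Fin 4, ∫ θ, Φ (insert x T) (Model.rotate θ x j) ∂(gaugeHaar d) =
        ∫ θ, Φ (insert x T) θ ∂(gaugeHaar d) := fun j =>
      integral_add_right_eq_self (Φ (insert x T)) (Pi.single x ((j : ℕ) • Model.quarterTurn))
    have h2 : ∫ θ, ∑ j : Fin 4, Φ (insert x T) (Model.rotate θ x j) ∂(gaugeHaar d) ≤
        ∫ θ, 4 * (K * Φ T θ) ∂(gaugeHaar d) :=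
      integral_mono (integrable_finsetSum _ fun j _ => hint j)
        (integrable_of_continuous_of_compactSpace (((hΦ T).const_mul K).const_mul 4))
        (hstep T x hx)
    rw [integral_finsetSum _ fun j _ => hint j, Finset.sum_congr rfl fun j _ => h1 j,
      Finset.sum_const, Finset.card_univ, Fintype.card_fin, integral_const_mul,
      integral_const_mul, nsmul_eq_mul] at h2
    rw [Finset.card_insert_of_notMem hx, pow_succ, mul_right_comm]
    have h3 := mul_le_mul_of_nonneg_left ih hK
    push_cast at h2
    linarith

/-- The Borel–Cantelli lemma along a chain of finite sets: distinct members have distinct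
cardinalities, so that bounds summable in the cardinality suffice, however often a member of the
chain is repeated. -/
theorem ae_eventually_notMem_of_summable_card {X : Type*} [MeasurableSpace X] {P : Measure X}
    [IsProbabilityMeasure P] {Λ : ℕ → Finset (Site d)} (hmono : Monotone Λ)
    (hcard : Tendsto (fun n => (Λ n).card) atTop atTop) (B : Finset (Site d) → Set X) {q : ℕ → ℝ}
    (hq : Summable q) (hB : ∀ n, 0 < (Λ n).card → P.real (B (Λ n)) ≤ q (Λ n).card) :
    ∀ᵐ A ∂P, ∀ᶠ n in atTop, A ∉ B (Λ n) := by
  let S : ℕ → Set X := fun N => ⋃ n ∈ {n | (Λ n).card = N}, B (Λ n)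
  have hS : ∀ N, 0 < N → P.real (S N) ≤ |q N| := by
    intro N hN
    by_cases h : ∃ n, (Λ n).card = N
    · obtain ⟨n, hn⟩ := h
      have hsub : S N ⊆ B (Λ n) := by
        refine Set.iUnion₂_subset fun m hm => ?_
        have hm' : (Λ m).card = N := hm
        have heq : Λ m = Λ n := by
          rcases le_total m n with hmn | hmn
          · exact Finset.eq_of_subset_of_card_le (hmono hmn) (by omega)
          · exact (Finset.eq_of_subset_of_card_le (hmono hmn) (by omega)).symm
        rw [heq]
      have h1 := hB n (by omega)
      rw [hn] at h1
      exact (measureReal_mono hsub).trans (h1.trans (le_abs_self _))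
    · have : S N = ∅ := by
        simp only [S, Set.iUnion_eq_empty]
        exact fun n hn => absurd ⟨n, hn⟩ h
      rw [this, measureReal_empty]
      positivity
  have hsum : ∑' N, P (S N) ≠ ⊤ := by
    have h1 : Summable fun N => P.real (S N) := by
      rw [← summable_nat_add_iff 1]
      refine Summable.of_nonneg_of_le (fun _ => measureReal_nonneg)
        (fun N => hS (N + 1) (Nat.succ_pos N)) ?_
      exact (summable_nat_add_iff 1).mpr hq.abs
    have h2 : (fun N => P (S N)) = fun N => ENNReal.ofReal (P.real (S N)) := by
      ext N; exact (ofReal_measureReal (measure_ne_top P _)).symm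
    rw [h2]
    exact h1.tsum_ofReal_ne_top
  filter_upwards [ae_eventually_notMem hsum] with A hA
  filter_upwards [hcard.eventually hA] with n hn hmem
  exact hn (Set.mem_biUnion (s := {m | (Λ m).card = (Λ n).card}) rfl hmem)

theorem eventually_subset {Λ : ℕ → Finset (Site d)} (hmono : Monotone Λ)
    (hexh : ∀ x, ∃ n, x ∈ Λ n) (s : Finset (Site d)) : ∀ᶠ n in atTop, s ⊆ Λ n := by
  have : ∀ᶠ n in atTop, ∀ x ∈ s, x ∈ Λ n := by
    rw [Filter.eventually_all_finset]
    intro x _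
    obtain ⟨n, hn⟩ := hexh x
    exact eventually_atTop.mpr ⟨n, fun m hm => hmono hm hn⟩
  exact this

theorem tendsto_card_atTop (hd : 1 ≤ d) {Λ : ℕ → Finset (Site d)} (hmono : Monotone Λ)
    (hexh : ∀ x, ∃ n, x ∈ Λ n) : Tendsto (fun n => (Λ n).card) atTop atTop := by
  have : Nonempty (Fin d) := ⟨⟨0, hd⟩⟩
  refine tendsto_atTop.mpr fun k => ?_
  obtain ⟨s, hs⟩ := Infinite.exists_subset_card_eq (Site d) k
  filter_upwards [eventually_subset hmono hexh s] with n hn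
  rw [← hs]
  exact Finset.card_le_card hn

/-- The distribution of the pure gauge fields of independent uniformly distributed gauge
functions. -/
noncomputable def zeroFluxMeasure (d : ℕ) : Measure (GaugeField d) :=
  (gaugeHaar d).map pureGauge

theorem continuous_pureGauge :
    Continuous (pureGauge : (Site d → Angle) → GaugeField d) := by
  unfold pureGauge; fun_prop

instance isProbabilityMeasure_zeroFluxMeasure :
    IsProbabilityMeasure (zeroFluxMeasure d) :=
  Measure.isProbabilityMeasure_map continuous_pureGauge.measurable.aemeasurable

/-- Markov's inequality, for a threshold `g` that is constant on the pure gauge fields. -/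
theorem zeroFluxMeasure_real_le {f g : GaugeField d → ℝ} (hf : Continuous f)
    (hg : Continuous g) (hf0 : ∀ A, 0 ≤ f A) {a : ℝ} (ha : 0 < a)
    (hga : ∀ θ, g (pureGauge θ) = a) :
    (zeroFluxMeasure d).real {A | g A ≤ f A} ≤ (∫ θ, f (pureGauge θ) ∂(gaugeHaar d)) / a := by
  rw [zeroFluxMeasure, map_measureReal_apply continuous_pureGauge.measurable
    (isClosed_le hg hf).measurableSet, le_div_iff₀' ha]
  have hint : Integrable (fun θ => f (pureGauge θ)) (gaugeHaar d) :=
    integrable_of_continuous_of_compactSpace (hf.comp continuous_pureGauge)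
  refine le_trans (le_of_eq ?_)
    (mul_meas_ge_le_integral_of_nonneg (ae_of_all _ fun θ => hf0 _) hint a)
  congr 2
  ext θ
  simp [hga]

end Averages

/-! ### Partition function and magnetization in finite volume -/

namespace Model

variable {d : ℕ} (model : Model d) (Λ : Finset (Site d))

theorem continuous_pairingOn (T : Finset (Site d)) :
    Continuous fun θ : Site d → Angle => model.pairingOn Λ T θ := by
  unfold pairingOn
  refine continuous_finsetSum _ fun a _ => continuous_finsetSum _ fun b _ => ?_
  split_ifs
  · have h : Continuous fun θ : Site d → Angle => phase (θ a.1) * phase (θ b.1) :=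
      (continuous_phase.comp (continuous_apply a.1)).mul
        (continuous_phase.comp (continuous_apply b.1))
    exact (h.star.smul continuous_const).add (h.smul continuous_const)
  · exact continuous_const

theorem continuous_link (x y : Site d) : Continuous fun A : GaugeField d => link A x y := by
  unfold link
  refine continuous_finsetSum _ fun i _ => ?_
  split_ifs
  · exact continuous_apply _
  · exact (continuous_apply _).neg
  · exact continuous_const

theorem continuous_exponent (β h : ℝ) :
    Continuous fun A : GaugeField d => model.exponent Λ β h A := by
  have hop : Continuous fun A : GaugeField d => model.hopping Λ A := by
    unfold hopping
    refine continuous_finsetSum _ fun x _ => continuous_finsetSum _ fun y _ =>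
      continuous_finsetSum _ fun α _ => continuous_finsetSum _ fun γ _ => ?_
    exact (continuous_const.mul (continuous_phase.comp (continuous_link x.1 y.1))).smul
      continuous_const
  unfold exponent hamiltonian
  fun_prop

/-- The partition function. -/
noncomputable def partition (β h : ℝ) (A : GaugeField d) : ℝ :=
  (NormedSpace.exp (model.exponent Λ β h A)).trace.re

theorem partition_pos (β h : ℝ) (A : GaugeField d) : 0 < model.partition Λ β h A :=
  trace_exp_re_pos (model.isHermitian_exponent Λ β h A)

/-- In a pure gauge field the gauge can be removed, at the cost of phases in the pairing field. -/
theorem partition_pureGauge (β h : ℝ) (θ : Site d → Angle) :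
    model.partition Λ β h (pureGauge θ) =
      (NormedSpace.exp (model.exponent Λ β 0 0 +
        ((β * h : ℝ) : ℂ) • model.pairingOn Λ Λ θ)).trace.re := by
  rw [← gaugeAut_exponent, ← gaugeAut_exp, trace_gaugeAut, zero_add, partition]

theorem gibbsSquare_pureGauge (β : ℝ) (θ : Site d → Angle) :
    gibbsSquare (model.exponent Λ β 0 (pureGauge θ)) (model.pairing Λ) =
      gibbsSquare (model.exponent Λ β 0 0) (model.pairingOn Λ Λ θ) := by
  have h := model.gaugeAut_exponent Λ β 0 0 θ
  rw [zero_add, mul_zero, Complex.ofReal_zero, zero_smul, add_zero] at h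
  rw [gibbsSquare, gibbsSquare, ← h, ← gaugeAut_pairing, ← gaugeAut_exp, ← map_mul, ← map_mul,
    trace_gaugeAut, trace_gaugeAut]

/-- Bound of the average partition function in a symmetry breaking field: the average over the
phase at a site removes all Cooper pairs at that site up to a second order factor. -/
theorem integral_partition_le {c : ℝ} (hc : model.IsPairBound c)
    {β h : ℝ} (hβh : 0 ≤ β * h) (hsmall : (β * h * c) ^ 2 ≤ 1) :
    ∫ θ, model.partition Λ β h (pureGauge θ) ∂(gaugeHaar d) ≤
      Real.exp (2 * (β * h * c) ^ 2) ^ Λ.card * model.partition Λ β 0 0 := by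
  simp only [partition_pureGauge]
  refine (integral_le_of_sum_rotate_le (Φ := fun T θ => (NormedSpace.exp (model.exponent Λ β 0 0 +
        ((β * h : ℝ) : ℂ) • model.pairingOn Λ T θ)).trace.re)
    (fun T => continuous_trace_re_exp (by
      have := model.continuous_pairingOn Λ T
      fun_prop))
    (Real.exp_pos (2 * (β * h * c) ^ 2)).le ?_ Λ).trans ?_
  · intro T x hx θ
    obtain ⟨V, hV, hsum, hnorm, heq⟩ := model.exists_pairingOn_insert Λ hc hx θ
    simp only [heq, smul_add, ← add_assoc]
    have h := sum_trace_exp_add_le (V := fun j => ((β * h : ℝ) : ℂ) • V j)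
      ((model.isHermitian_exponent Λ β 0 0).add
        (isHermitian_ofReal_smul (model.isHermitian_pairingOn Λ T θ) (β * h)))
      (fun j => isHermitian_ofReal_smul (hV j) _) (by rw [← Finset.smul_sum, hsum, smul_zero])
      (fun j => by
        rw [norm_smul, Complex.norm_real, Real.norm_of_nonneg hβh]
        exact mul_le_mul_of_nonneg_left (hnorm j) hβh) hsmall
    simpa using h
  · have : model.pairingOn Λ ∅ = fun _ => 0 := by ext1 θ; simp [pairingOn]
    simp [this, partition]

/-- Bound of the fourth moment of the pairing operator without symmetry breaking field. -/
theorem integral_gibbsSquare_le {c : ℝ} (hc0 : 0 < c) (hc : model.IsPairBound c)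
    (β : ℝ) (hΛ : 0 < Λ.card) :
    ∫ θ, (gibbsSquare (model.exponent Λ β 0 (pureGauge θ)) (model.pairing Λ) + Λ.card) ^ 2
        ∂(gaugeHaar d) ≤ Real.exp (10 * c ^ 2 + 2 * c ^ 4) * (Λ.card : ℝ) ^ 2 := by
  simp only [gibbsSquare_pureGauge]
  have hN : (1 : ℝ) ≤ Λ.card := by exact_mod_cast hΛ
  refine (integral_le_of_sum_rotate_le (Φ := fun T θ =>
      (gibbsSquare (model.exponent Λ β 0 0) (model.pairingOn Λ T θ) + Λ.card) ^ 2)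
    (fun T => ((continuous_gibbsSquare (model.continuous_pairingOn Λ T) continuous_const
      fun _ => model.isHermitian_exponent Λ β 0 0).add continuous_const).pow 2)
    (Real.exp_pos ((10 * c ^ 2 + 2 * c ^ 4) / Λ.card)).le ?_ Λ).trans ?_
  · intro T x hx θ
    obtain ⟨V, hV, hsum, hnorm, heq⟩ := model.exists_pairingOn_insert Λ hc hx θ
    simp only [heq]
    simpa using sum_gibbsSquare_add_sq_le (model.isHermitian_exponent Λ β 0 0)
      (model.isHermitian_pairingOn Λ T θ) hV hsum hc0 hnorm hN
  · have : model.pairingOn Λ ∅ = fun _ => 0 := by ext1 θ; simp [pairingOn]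
    rw [← Real.exp_nat_mul, mul_div_cancel₀ _ (by positivity)]
    simp [this, gibbsSquare]

theorem trace_exp_eq_partition (β h : ℝ) (A : GaugeField d) :
    (NormedSpace.exp (model.exponent Λ β h A)).trace = (model.partition Λ β h A : ℂ) :=
  Complex.ext rfl (by
    rw [trace_im_eq_zero (model.isHermitian_exponent Λ β h A).exp, Complex.ofReal_im])

theorem expect_re (β h : ℝ) (A : GaugeField d) (O : FockOp Λ) :
    (model.expect Λ β h A O).re =
      (O * NormedSpace.exp (model.exponent Λ β h A)).trace.re / model.partition Λ β h A := by
  rw [expect, boltzmann, ← exponent, trace_exp_eq_partition, Complex.div_ofReal_re]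

theorem card_mul_magnetization (hΛ : 0 < Λ.card) (β h : ℝ) (A : GaugeField d) :
    Λ.card * model.magnetization Λ β h A =
      (model.pairing Λ * NormedSpace.exp (model.exponent Λ β h A)).trace.re /
        model.partition Λ β h A := by
  have hN : (Λ.card : ℝ) ≠ 0 := by positivity
  have e : ((Λ.card : ℂ)⁻¹) = (((Λ.card : ℝ)⁻¹ : ℝ) : ℂ) := by push_cast; rfl
  rw [magnetization, expect_re, orderParameter, e, smul_mul_assoc, Matrix.trace_smul, smul_eq_mul,
    Complex.re_ofReal_mul]
  field_simp

theorem orderCorrelation_eq (β : ℝ) (A : GaugeField d) :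
    model.orderCorrelation Λ β A =
      Real.sqrt (gibbsSquare (model.exponent Λ β 0 A) (model.pairing Λ) / (Λ.card : ℝ) ^ 2) := by
  have e : ((Λ.card : ℂ)⁻¹) ^ 2 = ((((Λ.card : ℝ) ^ 2)⁻¹ : ℝ) : ℂ) := by push_cast; simp
  rw [orderCorrelation, expect_re, orderParameter, smul_pow, e, smul_mul_assoc, Matrix.trace_smul,
    smul_eq_mul, Complex.re_ofReal_mul, gibbsSquare, pow_two (model.pairing Λ), partition]
  congr 1
  ring

/-- Convexity of the free energy in the symmetry breaking field. -/
theorem exp_magnetization_mul_partition_le (hΛ : 0 < Λ.card) (β h s : ℝ) (A : GaugeField d) :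
    Real.exp (β * s * (Λ.card * model.magnetization Λ β h A)) * model.partition Λ β h A ≤
      model.partition Λ β (h + s) A := by
  have := peierls_bogoliubov (model.isHermitian_exponent Λ β h A)
    (isHermitian_ofReal_smul (model.isHermitian_pairing Λ) (β * s))
  rw [← exponent_add, smul_mul_assoc, Matrix.trace_smul, smul_eq_mul, Complex.re_ofReal_mul,
    mul_div_assoc] at this
  rw [card_mul_magnetization _ _ hΛ]
  exact this

/-- Without symmetry breaking field, the global `U(1)` symmetry forces the magnetization to
vanish: the constant rotation by `π / 2` turns the pairing operator into its negative. -/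
theorem magnetization_zero (hΛ : 0 < Λ.card) (β : ℝ) (A : GaugeField d) :
    Λ.card * model.magnetization Λ β 0 A = 0 := by
  have h0 : pureGauge (fun _ : Site d => quarterTurn) = 0 := by ext b; simp [pureGauge]
  have h1 := model.gaugeAut_exponent Λ β 0 A (fun _ => quarterTurn)
  rw [h0, add_zero, mul_zero, Complex.ofReal_zero, zero_smul, add_zero] at h1
  have hI : phase quarterTurn = Complex.I := by simpa using phase_nsmul_quarterTurn 1
  have h2 : gaugeAut Λ (fun _ => quarterTurn) (model.pairing Λ) = -model.pairing Λ := by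
    rw [gaugeAut_pairing, ← pairingOn_zero, pairingOn, pairingOn, ← Finset.sum_neg_distrib]
    refine Finset.sum_congr rfl fun a _ => ?_
    rw [← Finset.sum_neg_distrib]
    refine Finset.sum_congr rfl fun b _ => ?_
    rw [hI, Complex.I_mul_I]
    split_ifs
    · simp [pairTerm, phase_zero, add_comm]
    · simp
  have h3 := trace_gaugeAut (fun _ => quarterTurn)
    (model.pairing Λ * NormedSpace.exp (model.exponent Λ β 0 A))
  rw [map_mul, gaugeAut_exp, h1, h2, Matrix.neg_mul, Matrix.trace_neg] at h3
  have h4 := congrArg Complex.re h3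
  rw [Complex.neg_re] at h4
  rw [card_mul_magnetization _ _ hΛ, show (model.pairing Λ *
    NormedSpace.exp (model.exponent Λ β 0 A)).trace.re = 0 by linarith, zero_div]

/-- Convexity and the symmetry make `h = 0` a minimum of the partition function. -/
theorem partition_zero_le (hΛ : 0 < Λ.card) (β h : ℝ) (A : GaugeField d) :
    model.partition Λ β 0 A ≤ model.partition Λ β h A := by
  have := model.exp_magnetization_mul_partition_le Λ hΛ β 0 h A
  rwa [magnetization_zero _ _ hΛ, mul_zero, Real.exp_zero, one_mul, zero_add] at this

theorem magnetization_nonneg (hΛ : 0 < Λ.card) {β h : ℝ} (hβ : 0 < β) (hh : 0 < h)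
    (A : GaugeField d) : 0 ≤ model.magnetization Λ β h A := by
  have h1 := model.exp_magnetization_mul_partition_le Λ hΛ β h (-h) A
  rw [add_neg_cancel] at h1
  have h2 := model.partition_zero_le Λ hΛ β h A
  have h3 : Real.exp (β * -h * (Λ.card * model.magnetization Λ β h A)) ≤ 1 := by
    refine le_of_mul_le_mul_right ?_ (model.partition_pos Λ β h A)
    rw [one_mul]; exact h1.trans h2
  rw [Real.exp_le_one_iff] at h3
  have hN : (0 : ℝ) < Λ.card := by exact_mod_cast hΛ
  by_contra hneg
  have : 0 < β * h * (Λ.card * -model.magnetization Λ β h A) := by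
    have : 0 < -model.magnetization Λ β h A := by linarith
    positivity
  linarith

/-- The magnetization in the field `h` is controlled by the partition function in a field
`h' > 2 h`. -/
theorem magnetization_le (hΛ : 0 < Λ.card) {β h h' x : ℝ} (hβ : 0 < β) (hh : 0 < h)
    (hh' : 2 * h < h') {A : GaugeField d}
    (hx : model.partition Λ β h' A < Real.exp (x * Λ.card) * model.partition Λ β 0 A) :
    model.magnetization Λ β h A ≤ x / (β * h) := by
  have h1 := model.exp_magnetization_mul_partition_le Λ hΛ β h (h' - h) A
  rw [add_sub_cancel] at h1
  have h2 := mul_le_mul_of_nonneg_left (model.partition_zero_le Λ hΛ β h A)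
    (Real.exp_pos (x * Λ.card)).le
  have h3 := lt_of_mul_lt_mul_right (h1.trans_lt (hx.trans_le h2)) (model.partition_pos Λ β h A).le
  rw [Real.exp_lt_exp] at h3
  have hN : (0 : ℝ) < Λ.card := by exact_mod_cast hΛ
  have hm := model.magnetization_nonneg Λ hΛ hβ hh A
  rw [le_div_iff₀ (by positivity)]
  have h4 : β * (h' - h) * model.magnetization Λ β h A < x := by
    refine lt_of_mul_lt_mul_right ?_ hN.le
    linarith
  have h5 : 0 ≤ β * (h' - 2 * h) * model.magnetization Λ β h A :=
    mul_nonneg (mul_nonneg hβ.le (by linarith)) hm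
  linarith

end Model

namespace Model

/-! ### Absence of order in almost every pure gauge field -/

variable {d : ℕ} (model : Model d)

theorem continuous_partition (Λ : Finset (Site d)) (β h : ℝ) :
    Continuous fun A : GaugeField d => model.partition Λ β h A :=
  continuous_trace_re_exp (model.continuous_exponent Λ β h)

/-- Markov's inequality for the average partition function, with exponentially small bounds. -/
theorem ae_eventually_partition_lt (hd : 1 ≤ d) {Λ : ℕ → Finset (Site d)} (hmono : Monotone Λ)
    (hexh : ∀ x, ∃ n, x ∈ Λ n) {c : ℝ} (hc0 : 0 < c)
    (hc : model.IsPairBound c)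
    {β h : ℝ} (hβ : 0 < β) (hh : 0 < h) (hsmall : (β * h * c) ^ 2 ≤ 1) :
    ∀ᵐ A ∂(zeroFluxMeasure d), ∀ᶠ n in atTop, model.partition (Λ n) β h A <
      Real.exp (3 * (β * h * c) ^ 2 * (Λ n).card) * model.partition (Λ n) β 0 A := by
  set x := (β * h * c) ^ 2 with hx
  have hx0 : 0 < x := by positivity
  have hq : Summable fun N : ℕ => Real.exp (-x) ^ N :=
    summable_geometric_of_lt_one (Real.exp_pos _).le (Real.exp_lt_one_iff.mpr (by linarith))
  have key := ae_eventually_notMem_of_summable_card (P := zeroFluxMeasure d) hmono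
    (tendsto_card_atTop hd hmono hexh)
    (fun L => {A | Real.exp (3 * x * L.card) * model.partition L β 0 A ≤ model.partition L β h A})
    hq (fun n _ => by
      set L := Λ n
      have hZ := model.partition_pos L β 0 0
      refine (zeroFluxMeasure_real_le (model.continuous_partition L β h)
        (continuous_const.mul (model.continuous_partition L β 0))
        (fun A => (model.partition_pos L β h A).le)
        (a := Real.exp (3 * x * L.card) * model.partition L β 0 0) (by positivity)
        (fun θ => ?_)).trans ?_
      · change _ * model.partition L β 0 (pureGauge θ) = _
        rw [partition_pureGauge]
        simp [partition]
      · rw [div_le_iff₀ (by positivity)]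
        refine (model.integral_partition_le L hc (by positivity) hsmall).trans (le_of_eq ?_)
        rw [← mul_assoc, ← Real.exp_nat_mul, ← Real.exp_nat_mul, ← Real.exp_add]
        congr 2
        ring)
  filter_upwards [key] with A hA
  filter_upwards [hA] with n hn
  exact not_le.mp hn

/-- Chebyshev's inequality for `⟨H_ext²⟩`: its second moment is of order `|Λ|²`, so that the
probability of the value `ε |Λ|²` is of the summable order `|Λ|⁻²`. -/
theorem ae_eventually_gibbsSquare_lt (hd : 1 ≤ d) {Λ : ℕ → Finset (Site d)} (hmono : Monotone Λ)
    (hexh : ∀ x, ∃ n, x ∈ Λ n) (β : ℝ) {ε : ℝ} (hε : 0 < ε) :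
    ∀ᵐ A ∂(zeroFluxMeasure d), ∀ᶠ n in atTop,
      gibbsSquare (model.exponent (Λ n) β 0 A) (model.pairing (Λ n)) <
        ε * ((Λ n).card : ℝ) ^ 2 := by
  obtain ⟨c, hc0, hc⟩ := model.exists_isPairBound
  set C := Real.exp (10 * c ^ 2 + 2 * c ^ 4)
  have hq : Summable fun N : ℕ => C / ε ^ 2 * (1 / (N : ℝ) ^ 2) :=
    (Real.summable_one_div_nat_pow.mpr one_lt_two).mul_left _
  have hcard := tendsto_card_atTop hd hmono hexh
  have key := ae_eventually_notMem_of_summable_card (P := zeroFluxMeasure d) hmono hcard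
    (fun L => {A | (ε * (L.card : ℝ) ^ 2) ^ 2 ≤
      (gibbsSquare (model.exponent L β 0 A) (model.pairing L) + L.card) ^ 2})
    hq (fun n hn => by
      set L := Λ n
      have hN : (0 : ℝ) < L.card := by exact_mod_cast hn
      refine (zeroFluxMeasure_real_le
        (((continuous_gibbsSquare continuous_const (model.continuous_exponent L β 0)
          fun _ => model.isHermitian_exponent L β 0 _).add continuous_const).pow 2)
        continuous_const (fun A => sq_nonneg _)
        (a := (ε * (L.card : ℝ) ^ 2) ^ 2) (by positivity) (fun θ => rfl)).trans ?_
      rw [div_le_iff₀ (by positivity)]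
      have hI := model.integral_gibbsSquare_le L hc0 hc β hn
      change _ ≤ C * _ at hI
      refine hI.trans (le_of_eq ?_)
      field_simp)
  filter_upwards [key] with A hA
  filter_upwards [hA, hcard.eventually_ge_atTop 1] with n hn hn1
  have h1 : (gibbsSquare (model.exponent (Λ n) β 0 A) (model.pairing (Λ n)) + (Λ n).card) ^ 2 <
      (ε * ((Λ n).card : ℝ) ^ 2) ^ 2 := not_le.mp hn
  have h2 := lt_of_pow_lt_pow_left₀ 2 (by positivity) h1
  have h3 : (0 : ℝ) < (Λ n).card := by exact_mod_cast hn1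
  linarith

theorem longRangeOrder_eq_of_eventually {Λ : ℕ → Finset (Site d)} {β : ℝ} {A : GaugeField d}
    (h : ∀ k : ℕ, ∀ᶠ n in atTop,
      gibbsSquare (model.exponent (Λ n) β 0 A) (model.pairing (Λ n)) <
        1 / ((k : ℝ) + 1) * ((Λ n).card : ℝ) ^ 2) :
    model.longRangeOrder Λ β A = {0} := by
  have hlim : Tendsto (fun n => gibbsSquare (model.exponent (Λ n) β 0 A) (model.pairing (Λ n)) /
      ((Λ n).card : ℝ) ^ 2) atTop (𝓝 0) := by
    rw [Metric.tendsto_atTop]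
    intro ε hε
    obtain ⟨k, hk⟩ := exists_nat_one_div_lt hε
    obtain ⟨N, hN⟩ := eventually_atTop.mp (h k)
    refine ⟨N, fun n hn => ?_⟩
    have h0 := gibbsSquare_nonneg (model.isHermitian_exponent (Λ n) β 0 A)
      (model.isHermitian_pairing (Λ n))
    rw [Real.dist_eq, sub_zero, abs_of_nonneg (by positivity)]
    have h1 := hN n hn
    have hpos : (0 : ℝ) < ((Λ n).card : ℝ) ^ 2 := by
      by_contra hc
      have : ((Λ n).card : ℝ) ^ 2 = 0 := le_antisymm (not_lt.mp hc) (by positivity)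
      rw [this] at h1
      linarith
    rw [div_lt_iff₀ hpos]
    exact h1.trans_le (mul_le_mul_of_nonneg_right hk.le hpos.le)
  have hlim' : Tendsto (fun n => model.orderCorrelation (Λ n) β A) atTop (𝓝 0) := by
    simp only [orderCorrelation_eq]
    have h1 := (Real.continuous_sqrt.tendsto 0).comp hlim
    rwa [Real.sqrt_zero] at h1
  ext s
  constructor
  · intro hs
    exact eq_of_nhds_neBot (hs.clusterPt.mono hlim')
  · rintro rfl
    exact hlim'.mapClusterPt

theorem spontaneousMagnetization_eq_of_eventually {Λ : ℕ → Finset (Site d)} {β : ℝ}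
    {A : GaugeField d} {h₀ C : ℝ} (hh₀ : 0 < h₀)
    (H : ∀ h, 0 < h → h < h₀ →
      ∀ᶠ n in atTop, model.magnetization (Λ n) β h A ∈ Set.Icc 0 (C * h)) :
    model.spontaneousMagnetization Λ β A = {0} := by
  have hmem : ∀ h, 0 < h → h < h₀ →
      ∀ v ∈ model.magnetizationLimits Λ β h A, v ∈ Set.Icc 0 (C * h) := by
    intro h hh hh' v hv
    exact isClosed_Icc.mem_of_mapClusterPt hv (H h hh hh')
  ext m
  constructor
  · rintro ⟨h, v, hpos, hlim, hv, hvm⟩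
    have hev : ∀ᶠ k in atTop, v k ∈ Set.Icc 0 (C * h k) := by
      filter_upwards [hlim.eventually_lt_const hh₀] with k hk
      exact hmem (h k) (hpos k) hk (v k) (hv k)
    have hz : Tendsto v atTop (𝓝 0) :=
      tendsto_of_tendsto_of_tendsto_of_le_of_le' tendsto_const_nhds
        (by simpa using hlim.const_mul C) (hev.mono fun _ h => h.1) (hev.mono fun _ h => h.2)
    exact tendsto_nhds_unique hvm hz
  · rintro rfl
    -- accumulation points exist, by compactness, for fields below the threshold `h₀`
    have hpos : ∀ k : ℕ, 0 < h₀ / ((k : ℝ) + 2) := fun k => by positivity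
    have hlt : ∀ k : ℕ, h₀ / ((k : ℝ) + 2) < h₀ := fun k => by
      rw [div_lt_iff₀ (by positivity)]
      nlinarith [(Nat.cast_nonneg k : (0 : ℝ) ≤ k)]
    have hex : ∀ k : ℕ, ∃ v, v ∈ model.magnetizationLimits Λ β (h₀ / ((k : ℝ) + 2)) A := by
      intro k
      obtain ⟨v, -, hv⟩ := isCompact_Icc.exists_mapClusterPt_of_frequently
        (H _ (hpos k) (hlt k)).frequently
      exact ⟨v, hv⟩
    choose v hv using hex
    have hlim : Tendsto (fun k : ℕ => h₀ / ((k : ℝ) + 2)) atTop (𝓝 0) :=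
      tendsto_const_nhds.div_atTop
        (tendsto_atTop_add_const_right _ _ tendsto_natCast_atTop_atTop)
    refine ⟨fun k => h₀ / ((k : ℝ) + 2), v, hpos, hlim, hv, ?_⟩
    exact tendsto_of_tendsto_of_tendsto_of_le_of_le tendsto_const_nhds
      (by simpa using hlim.const_mul C)
      (fun k => (hmem _ (hpos k) (hlt k) _ (hv k)).1)
      (fun k => (hmem _ (hpos k) (hlt k) _ (hv k)).2)

theorem ae_order_eq_zero (hd : 1 ≤ d) {Λ : ℕ → Finset (Site d)} (hmono : Monotone Λ)
    (hexh : ∀ x, ∃ n, x ∈ Λ n) {β : ℝ} (hβ : 0 < β) :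
    ∀ᵐ A ∂(zeroFluxMeasure d), model.spontaneousMagnetization Λ β A = {0} ∧
      model.longRangeOrder Λ β A = {0} := by
  obtain ⟨c, hc0, hc⟩ := model.exists_isPairBound
  have hcard := tendsto_card_atTop hd hmono hexh
  have h1 : ∀ᵐ A ∂(zeroFluxMeasure d), ∀ h' : ℚ, 0 < h' → (β * h' * c) ^ 2 ≤ 1 →
      ∀ᶠ n in atTop, model.partition (Λ n) β h' A <
        Real.exp (3 * (β * h' * c) ^ 2 * (Λ n).card) * model.partition (Λ n) β 0 A := by
    rw [ae_all_iff]
    intro h'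
    by_cases hh : 0 < h' ∧ (β * h' * c) ^ 2 ≤ 1
    · filter_upwards [model.ae_eventually_partition_lt hd hmono hexh hc0 hc hβ
        (h := (h' : ℝ)) (by exact_mod_cast hh.1) hh.2] with A hA _ _ using hA
    · exact ae_of_all _ fun A h2 h3 => absurd ⟨h2, h3⟩ hh
  have h2 : ∀ᵐ A ∂(zeroFluxMeasure d), ∀ k : ℕ, ∀ᶠ n in atTop,
      gibbsSquare (model.exponent (Λ n) β 0 A) (model.pairing (Λ n)) <
        1 / ((k : ℝ) + 1) * ((Λ n).card : ℝ) ^ 2 :=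
    ae_all_iff.mpr fun k => model.ae_eventually_gibbsSquare_lt hd hmono hexh β (by positivity)
  filter_upwards [h1, h2] with A hA1 hA2
  refine ⟨model.spontaneousMagnetization_eq_of_eventually (h₀ := 1 / (3 * β * c))
    (C := 27 * β * c ^ 2) (by positivity) ?_, model.longRangeOrder_eq_of_eventually hA2⟩
  intro h hh hh₀
  -- a rational field between `2 h` and `3 h` reduces uncountably many events to countably many
  obtain ⟨h', hlow, hup⟩ := exists_rat_btwn (by linarith : 2 * h < 3 * h)
  have hh'0 : (0 : ℝ) < h' := by linarith
  have hle : β * h' * c ≤ β * (3 * h) * c := by gcongr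
  have hsmall : (β * h' * c) ^ 2 ≤ 1 := by
    rw [lt_div_iff₀ (by positivity)] at hh₀
    have : 0 ≤ β * h' * c := by positivity
    nlinarith
  filter_upwards [hA1 h' (by exact_mod_cast hh'0) hsmall, hcard.eventually_ge_atTop 1]
    with n hn hn1
  refine ⟨model.magnetization_nonneg (Λ n) hn1 hβ hh A, ?_⟩
  refine (model.magnetization_le (Λ n) hn1 hβ hh hlow hn).trans ?_
  rw [div_le_iff₀ (by positivity)]
  have h0 : 0 ≤ β * h' * c := by positivity
  calc 3 * (β * h' * c) ^ 2 ≤ 3 * (β * (3 * h) * c) ^ 2 := by gcongr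
    _ = 27 * β * c ^ 2 * h * (β * h) := by ring

end Model
/-! ### The zero temperature limit of the gauge field -/

section Concentration

/-- Laplace's principle: the probability measures with density proportional to `e^{κ S}` concentrate
on the maximizers of `S`. -/
theorem tendsto_integral_exp_mul_div {X : Type*} [TopologicalSpace X] [CompactSpace X]
    [MeasurableSpace X] [OpensMeasurableSpace X] {μ : Measure X} [IsFiniteMeasure μ]
    [μ.IsOpenPosMeasure] {S φ : X → ℝ} (hS : Continuous S) (hφ : Continuous φ) {m l : ℝ}
    (hm : ∀ x, S x ≤ m) {x₀ : X} (hx₀ : S x₀ = m) (hl : ∀ x, S x = m → φ x = l) :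
    Tendsto (fun κ : ℝ => (∫ x, Real.exp (κ * S x) * φ x ∂μ) / ∫ x, Real.exp (κ * S x) ∂μ)
      atTop (𝓝 l) := by
  have hint : ∀ {f : X → ℝ}, Continuous f → Integrable f μ :=
    fun hf => integrable_of_continuous_of_compactSpace hf
  rw [Metric.tendsto_nhds]
  intro ε hε
  obtain ⟨M, hM⟩ : ∃ M, ∀ x, |φ x - l| ≤ M := by
    obtain ⟨M, hM⟩ := isCompact_univ.exists_bound_of_continuousOn
      (hφ.sub continuous_const : Continuous fun x => φ x - l).continuousOn
    exact ⟨M, fun x => hM x (Set.mem_univ x)⟩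
  have hM0 : 0 ≤ M := (abs_nonneg _).trans (hM x₀)
  obtain ⟨δ, hδ, hgap⟩ : ∃ δ > 0, ∀ x, ε / 2 ≤ |φ x - l| → S x ≤ m - 2 * δ := by
    have hC : IsCompact {x | ε / 2 ≤ |φ x - l|} :=
      (isClosed_le continuous_const (by fun_prop)).isCompact
    rcases Set.eq_empty_or_nonempty {x | ε / 2 ≤ |φ x - l|} with he | hne
    · refine ⟨1, one_pos, fun x hx => ?_⟩
      have : x ∈ {x | ε / 2 ≤ |φ x - l|} := hx
      rw [he] at this
      exact this.elim
    · obtain ⟨y, hy, hmax⟩ := hC.exists_isMaxOn hne hS.continuousOn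
      have hlt : S y < m := by
        refine lt_of_le_of_ne (hm y) fun h => ?_
        have : ε / 2 ≤ |φ y - l| := hy
        rw [hl y h, sub_self, abs_zero] at this
        linarith
      refine ⟨(m - S y) / 2, by linarith, fun x hx => ?_⟩
      have : S x ≤ S y := hmax hx
      linarith
  -- away from the maximizers the weight is at most `e^{κ(m - 2δ)}`, while the neighbourhood
  -- `{S > m - δ}` contributes at least `e^{κ(m - δ)} w` to the normalization
  set w := μ.real {x | m - δ < S x} with hw
  have hwpos : 0 < w := by
    have hopen : IsOpen {x | m - δ < S x} := isOpen_lt continuous_const hS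
    refine ENNReal.toReal_pos (hopen.measure_pos μ ⟨x₀, ?_⟩).ne' (measure_ne_top _ _)
    change m - δ < S x₀
    linarith
  have hlim : Tendsto (fun κ : ℝ => M * μ.real Set.univ / w * Real.exp (-(κ * δ))) atTop (𝓝 0) := by
    have h1 : Tendsto (fun κ : ℝ => Real.exp (-(κ * δ))) atTop (𝓝 0) :=
      Real.tendsto_exp_neg_atTop_nhds_zero.comp (tendsto_id.atTop_mul_const hδ)
    simpa using h1.const_mul (M * μ.real Set.univ / w)
  filter_upwards [eventually_ge_atTop (0 : ℝ), hlim.eventually_lt_const (half_pos hε)] with κ hκ hsm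
  have hexp : Continuous fun x => Real.exp (κ * S x) := by fun_prop
  set D := ∫ x, Real.exp (κ * S x) ∂μ with hD
  have hDlow : Real.exp (κ * (m - δ)) * w ≤ D := by
    refine le_trans ?_ (mul_meas_ge_le_integral_of_nonneg
      (ae_of_all μ fun x => (Real.exp_pos (κ * S x)).le) (hint hexp) (Real.exp (κ * (m - δ))))
    refine mul_le_mul_of_nonneg_left (measureReal_mono fun x hx => ?_) (Real.exp_pos _).le
    exact Real.exp_le_exp.mpr (mul_le_mul_of_nonneg_left (le_of_lt hx) hκ)
  have hDpos : 0 < D := lt_of_lt_of_le (by positivity) hDlow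
  have hnum : |∫ x, Real.exp (κ * S x) * (φ x - l) ∂μ| ≤
      ε / 2 * D + M * Real.exp (κ * (m - 2 * δ)) * μ.real Set.univ := by
    calc |∫ x, Real.exp (κ * S x) * (φ x - l) ∂μ|
        ≤ ∫ x, |Real.exp (κ * S x) * (φ x - l)| ∂μ := abs_integral_le_integral_abs
      _ ≤ ∫ x, (ε / 2 * Real.exp (κ * S x) + M * Real.exp (κ * (m - 2 * δ))) ∂μ := by
          refine integral_mono (hint (by fun_prop)) (hint (by fun_prop)) fun x => ?_
          beta_reduce
          rw [abs_mul, abs_of_pos (Real.exp_pos _)]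
          have he := (Real.exp_pos (κ * S x)).le
          have he2 : 0 ≤ M * Real.exp (κ * (m - 2 * δ)) := by positivity
          rcases lt_or_ge |φ x - l| (ε / 2) with h | h
          · nlinarith
          · have h1 : Real.exp (κ * S x) ≤ Real.exp (κ * (m - 2 * δ)) :=
              Real.exp_le_exp.mpr (mul_le_mul_of_nonneg_left (hgap x h) hκ)
            have h2 : Real.exp (κ * S x) * |φ x - l| ≤ Real.exp (κ * (m - 2 * δ)) * M :=
              mul_le_mul h1 (hM x) (abs_nonneg _) (Real.exp_pos _).le
            have h3 : 0 ≤ ε / 2 * Real.exp (κ * S x) := by positivity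
            linarith
      _ = ε / 2 * D + M * Real.exp (κ * (m - 2 * δ)) * μ.real Set.univ := by
          rw [integral_add (hint (by fun_prop)) (integrable_const _), integral_const_mul,
            integral_const, smul_eq_mul, mul_comm (μ.real Set.univ)]
  have hdiff : (∫ x, Real.exp (κ * S x) * φ x ∂μ) / D - l =
      (∫ x, Real.exp (κ * S x) * (φ x - l) ∂μ) / D := by
    have : ∫ x, Real.exp (κ * S x) * (φ x - l) ∂μ =
        (∫ x, Real.exp (κ * S x) * φ x ∂μ) - D * l := by
      simp only [mul_sub]
      rw [integral_sub (hint (by fun_prop)) (hint (by fun_prop)), integral_mul_const]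
    rw [this]
    field_simp
  rw [Real.dist_eq, hdiff, abs_div, abs_of_pos hDpos, div_lt_iff₀ hDpos]
  have h4 : M * Real.exp (κ * (m - 2 * δ)) * μ.real Set.univ =
      (M * μ.real Set.univ / w * Real.exp (-(κ * δ))) * (Real.exp (κ * (m - δ)) * w) := by
    have : Real.exp (κ * (m - 2 * δ)) = Real.exp (-(κ * δ)) * Real.exp (κ * (m - δ)) := by
      rw [← Real.exp_add]; ring_nf
    rw [this]
    field_simp
  have h5 : (M * μ.real Set.univ / w * Real.exp (-(κ * δ))) * (Real.exp (κ * (m - δ)) * w) <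
      ε / 2 * D :=
    mul_lt_mul_of_lt_of_le_of_nonneg_of_pos hsm hDlow (by positivity) hDpos
  linarith

end Concentration

section ZeroFlux

variable {d : ℕ} {Λ : Finset (Site d)}

theorem continuous_angleCos : Continuous angleCos :=
  Real.continuous_cos.quotient_lift _

theorem angleCos_le_one (a : Angle) : angleCos a ≤ 1 := by
  induction a using QuotientAddGroup.induction_on with
  | H x => exact Real.cos_le_one x

theorem angleCos_zero : angleCos 0 = 1 := Real.cos_zero

theorem eq_zero_of_angleCos_eq_one {a : Angle} (h : angleCos a = 1) : a = 0 := by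
  induction a using QuotientAddGroup.induction_on with
  | H x =>
    obtain ⟨n, hn⟩ := (Real.cos_eq_one_iff x).mp h
    exact (AddCircle.coe_eq_zero_iff (2 * Real.pi)).mpr ⟨n, by rw [zsmul_eq_mul, hn]⟩

theorem extend_add (a b : LocalField Λ) : extend Λ (a + b) = extend Λ a + extend Λ b := by
  ext x
  by_cases h : x ∈ bonds Λ <;> simp [extend, h]

theorem extend_zero : extend Λ (0 : LocalField Λ) = 0 := by
  ext x
  by_cases h : x ∈ bonds Λ <;> simp [extend, h]

theorem continuous_extend : Continuous (extend Λ) := by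
  refine continuous_pi fun b => ?_
  by_cases h : b ∈ bonds Λ
  · simpa [extend, h] using continuous_apply (A := fun _ => Angle) (⟨b, h⟩ : {b // b ∈ bonds Λ})
  · simpa [extend, h] using continuous_const

theorem flux_add (A B : GaugeField d) (p : Site d × Fin d × Fin d) :
    flux (A + B) p = flux A p + flux B p := by
  simp only [flux, Pi.add_apply]; abel

theorem flux_zero (p : Site d × Fin d × Fin d) : flux (0 : GaugeField d) p = 0 := by
  simp [flux]

theorem flux_neg (A : GaugeField d) (p : Site d × Fin d × Fin d) : flux (-A) p = -flux A p := by
  simp only [flux, Pi.neg_apply]; abel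

theorem continuous_flux (p : Site d × Fin d × Fin d) :
    Continuous fun A : GaugeField d => flux A p := by
  unfold flux; fun_prop

theorem flux_pureGauge (θ : Site d → Angle) (p : Site d × Fin d × Fin d) :
    flux (pureGauge θ) p = 0 := by
  simp only [flux, pureGauge, add_right_comm p.1 (unitVec p.2.2)]
  abel

theorem flux_congr {A B : GaugeField d} (h : ∀ b ∈ bonds Λ, A b = B b)
    {p : Site d × Fin d × Fin d} (hp : p ∈ plaquettes Λ) : flux A p = flux B p := by
  simp only [plaquettes, Finset.mem_filter, Finset.mem_product, Finset.mem_univ, and_true] at hp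
  obtain ⟨h0, -, h1, h2, h3⟩ := hp
  have hb : ∀ x i, x ∈ Λ → x + unitVec i ∈ Λ → A (x, i) = B (x, i) := fun x i hx hxi =>
    h _ (by simp [bonds, hx, hxi])
  rw [flux, flux, hb _ _ h0 h1, hb _ _ h1 h3, hb _ _ h2 (by rwa [add_right_comm]), hb _ _ h0 h2]

theorem bonds_mono {Λ Λ' : Finset (Site d)} (h : Λ ⊆ Λ') : bonds Λ ⊆ bonds Λ' := by
  intro b hb
  simp only [bonds, Finset.mem_filter, Finset.mem_product, Finset.mem_univ, and_true] at hb ⊢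
  exact ⟨h hb.1, h hb.2⟩

theorem plaquettes_mono {Λ Λ' : Finset (Site d)} (h : Λ ⊆ Λ') :
    plaquettes Λ ⊆ plaquettes Λ' := by
  intro p hp
  simp only [plaquettes, Finset.mem_filter, Finset.mem_product, Finset.mem_univ, and_true] at hp ⊢
  exact ⟨h hp.1, hp.2.1, h hp.2.2.1, h hp.2.2.2.1, h hp.2.2.2.2⟩

/-- The closed subgroup of the gauge fields on `Λ` without flux. If `Λ` has holes, these need not
be pure gauge fields. -/
def zeroFlux (Λ : Finset (Site d)) : AddSubgroup (LocalField Λ) where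
  carrier := {a | ∀ p ∈ plaquettes Λ, flux (extend Λ a) p = 0}
  add_mem' ha hb p hp := by rw [extend_add, flux_add, ha p hp, hb p hp, add_zero]
  zero_mem' p _ := by rw [extend_zero, flux_zero]
  neg_mem' {a} ha p hp := by
    have h : extend Λ (-a) = -extend Λ a := by
      rw [eq_neg_iff_add_eq_zero, ← extend_add, neg_add_cancel, extend_zero]
    rw [h, flux_neg, ha p hp, neg_zero]

theorem isClosed_zeroFlux (Λ : Finset (Site d)) : IsClosed (zeroFlux Λ : Set (LocalField Λ)) := by
  have : (zeroFlux Λ : Set (LocalField Λ)) =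
      ⋂ p ∈ plaquettes Λ, {a | flux (extend Λ a) p = 0} := by
    ext a; simp [zeroFlux]
  rw [this]
  exact isClosed_biInter fun p _ =>
    isClosed_eq ((continuous_flux p).comp continuous_extend) continuous_const

instance compactSpace_zeroFlux (Λ : Finset (Site d)) : CompactSpace (zeroFlux Λ) :=
  isCompact_iff_compactSpace.mp (isClosed_zeroFlux Λ).isCompact

theorem continuous_plaquetteSum :
    Continuous fun a : LocalField Λ => plaquetteSum Λ (extend Λ a) := by
  unfold plaquetteSum
  exact continuous_finsetSum _ fun p _ =>
    continuous_angleCos.comp ((continuous_flux p).comp continuous_extend)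

theorem plaquetteSum_le (A : GaugeField d) : plaquetteSum Λ A ≤ (plaquettes Λ).card := by
  refine (Finset.sum_le_sum fun p _ => angleCos_le_one (flux A p)).trans ?_
  simp

theorem plaquetteSum_eq_card_iff (a : LocalField Λ) :
    plaquetteSum Λ (extend Λ a) = (plaquettes Λ).card ↔ a ∈ zeroFlux Λ := by
  have h := Finset.sum_eq_sum_iff_of_le (s := plaquettes Λ)
    (f := fun p => angleCos (flux (extend Λ a) p)) (g := fun _ => (1 : ℝ))
    (fun p _ => angleCos_le_one _)
  rw [Finset.sum_const, nsmul_eq_mul, mul_one] at h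
  rw [plaquetteSum, h]
  constructor
  · exact fun h p hp => eq_zero_of_angleCos_eq_one (h p hp)
  · intro h p hp
    rw [h p hp, angleCos_zero]

theorem plaquetteSum_add_of_mem (a : LocalField Λ) {u : LocalField Λ} (hu : u ∈ zeroFlux Λ) :
    plaquetteSum Λ (extend Λ (a + u)) = plaquetteSum Λ (extend Λ a) := by
  unfold plaquetteSum
  refine Finset.sum_congr rfl fun p hp => ?_
  rw [extend_add, flux_add, hu p hp, add_zero]

/-- In finite volume the gauge field becomes uniformly distributed on the subgroup of fields without
flux: the density is invariant under this subgroup, so that `f` can be replaced by its average over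
the cosets, which is constant on the set of maximizers of the density. -/
theorem tendsto_gaugeAverage (Λ : Finset (Site d)) {f : GaugeField d → ℝ} (hf : Continuous f) :
    Tendsto (fun κ : ℝ => gaugeAverage Λ κ f) atTop
      (𝓝 (∫ u : zeroFlux Λ, f (extend Λ u) ∂(haarProb (zeroFlux Λ)))) := by
  set ν := haarProb (zeroFlux Λ)
  have hfe : Continuous fun p : LocalField Λ × zeroFlux Λ => f (extend Λ (p.1 + p.2)) :=
    hf.comp (continuous_extend.comp (by fun_prop))
  set φ : LocalField Λ → ℝ := fun a => ∫ u : zeroFlux Λ, f (extend Λ (a + u)) ∂ν with hφ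
  have hφc : Continuous φ := by
    have := continuous_parametric_integral_of_continuous (μ := ν) (s := Set.univ)
      (f := fun (a : LocalField Λ) (u : zeroFlux Λ) => f (extend Λ (a + u))) hfe isCompact_univ
    simpa using this
  have havg : ∀ κ, gaugeAverage Λ κ f =
      (∫ a : LocalField Λ, Real.exp (κ * plaquetteSum Λ (extend Λ a)) * φ a) /
        ∫ a : LocalField Λ, Real.exp (κ * plaquetteSum Λ (extend Λ a)) := by
    intro κ
    rw [gaugeAverage]
    congr 1
    have hρ : Continuous fun a : LocalField Λ =>
        Real.exp (κ * plaquetteSum Λ (extend Λ a)) := by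
      have := continuous_plaquetteSum (Λ := Λ)
      fun_prop
    have h1 : ∀ u : zeroFlux Λ,
        ∫ a : LocalField Λ, Real.exp (κ * plaquetteSum Λ (extend Λ a)) * f (extend Λ (a + u)) =
        ∫ a : LocalField Λ, Real.exp (κ * plaquetteSum Λ (extend Λ a)) * f (extend Λ a) := by
      intro u
      rw [← integral_add_right_eq_self (fun a : LocalField Λ =>
        Real.exp (κ * plaquetteSum Λ (extend Λ a)) * f (extend Λ a)) (u : LocalField Λ)]
      simp only [plaquetteSum_add_of_mem _ u.2]
    calc ∫ a : LocalField Λ, Real.exp (κ * plaquetteSum Λ (extend Λ a)) * f (extend Λ a)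
        = ∫ _u : zeroFlux Λ, (∫ a : LocalField Λ,
            Real.exp (κ * plaquetteSum Λ (extend Λ a)) * f (extend Λ a)) ∂ν := by simp
      _ = ∫ u : zeroFlux Λ, (∫ a : LocalField Λ,
            Real.exp (κ * plaquetteSum Λ (extend Λ a)) * f (extend Λ (a + u))) ∂ν := by
          simp only [h1]
      _ = ∫ a : LocalField Λ, (∫ u : zeroFlux Λ,
            Real.exp (κ * plaquetteSum Λ (extend Λ a)) * f (extend Λ (a + u)) ∂ν) := by
          have : OpensMeasurableSpace (zeroFlux Λ × LocalField Λ) := Prod.opensMeasurableSpace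
          refine integral_integral_swap ?_
          refine integrable_of_continuous_of_compactSpace ?_
          exact (hρ.comp continuous_snd).mul (hfe.comp continuous_swap)
      _ = ∫ a : LocalField Λ, Real.exp (κ * plaquetteSum Λ (extend Λ a)) * φ a := by
          simp only [integral_const_mul, hφ]
  simp only [havg]
  refine tendsto_integral_exp_mul_div continuous_plaquetteSum hφc
    (fun a => plaquetteSum_le (extend Λ a)) (x₀ := 0)
    ((plaquetteSum_eq_card_iff 0).mpr (zero_mem _)) ?_
  intro a ha
  have hmem := (plaquetteSum_eq_card_iff a).mp ha
  exact integral_add_left_eq_self (fun u : zeroFlux Λ => f (extend Λ u)) ⟨a, hmem⟩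

end ZeroFlux

/-! ### The infinite volume limit of the gauge field -/

section InfiniteVolume

variable {d : ℕ}

/-- The box of side length `2 L` about the origin. -/
noncomputable def box (d L : ℕ) : Finset (Site d) :=
  Finset.Icc (fun _ => -(L : ℤ)) (fun _ => (L : ℤ))

theorem mem_box {L : ℕ} {x : Site d} : x ∈ box d L ↔ ∀ i, -(L : ℤ) ≤ x i ∧ x i ≤ L := by
  simp [box, Finset.mem_Icc, Pi.le_def, forall_and]

theorem pureGauge_add (θ ψ : Site d → Angle) :
    pureGauge (θ + ψ) = pureGauge θ + pureGauge ψ := by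
  ext b; simp only [pureGauge, Pi.add_apply]; abel

/-- The Poincaré lemma on a box: a gauge field without flux is a pure gauge field. The bonds are
gauged to zero one direction after the other. A field without flux that vanishes in the directions
`i < j` does not depend on the coordinates `x_i`, `i < j`, in the direction `j`, hence neither does
the gauge function that removes it in the direction `j`. -/
theorem exists_pureGauge_eq_of_flux_eq_zero {L : ℕ} {A : GaugeField d}
    (hA : ∀ p ∈ plaquettes (box d L), flux A p = 0) :
    ∃ θ, ∀ b ∈ bonds (box d L), A b = pureGauge θ b := by
  have key : ∀ k : ℕ, ∃ θ, ∀ b ∈ bonds (box d L), b.2.val < k → A b = pureGauge θ b := by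
    intro k
    induction k with
    | zero => exact ⟨0, fun b _ h => absurd h (Nat.not_lt_zero _)⟩
    | succ k ih =>
      obtain ⟨θ, hθ⟩ := ih
      by_cases hk : k < d
      swap
      · exact ⟨θ, fun b hb _ => hθ b hb (by omega)⟩
      let j : Fin d := ⟨k, hk⟩
      set B : GaugeField d := A + pureGauge (-θ) with hB
      have hneg : ∀ b, pureGauge (-θ) b = -pureGauge θ b := by
        intro b; simp only [pureGauge, Pi.neg_apply]; abel
      have hBflux : ∀ p ∈ plaquettes (box d L), flux B p = 0 := by
        intro p hp
        rw [hB, flux_add, hA p hp, flux_pureGauge, add_zero]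
      have hB0 : ∀ b ∈ bonds (box d L), b.2.val < k → B b = 0 := by
        intro b hb hbk
        rw [hB, Pi.add_apply, hneg, hθ b hb hbk, add_neg_cancel]
      -- the line integral of `B` in the direction `j`, from the face `x_j = -L` of the box to `x`
      let ψ : Site d → Angle := fun x =>
        ∑ m ∈ Finset.Ico (-(L : ℤ)) (x j), B (Function.update x j m, j)
      have hψj : ∀ x, x ∈ box d L → pureGauge ψ (x, j) = B (x, j) := by
        intro x hx
        have hxj := (mem_box.mp hx j).1
        have hu : ∀ m, Function.update (x + unitVec j) j m = Function.update x j m := by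
          intro m
          ext i
          by_cases hi : i = j
          · subst hi; simp
          · simp [hi, unitVec]
        have h1 : (x + unitVec j) j = x j + 1 := by simp [unitVec]
        simp only [pureGauge, ψ, hu, h1]
        rw [← Finset.insert_Ico_right_eq_Ico_add_one hxj,
          Finset.sum_insert Finset.right_notMem_Ico, Function.update_eq_self]
        abel
      -- the flux through the plaquettes in the directions `i, j` vanishes, so does `B` in the
      -- direction `i`; thus shifts in the direction `i` change neither `B (·, j)` nor `ψ`
      have hψi : ∀ x i, i < j → x ∈ box d L → x + unitVec i ∈ box d L →
          pureGauge ψ (x, i) = 0 := by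
        intro x i hij hx hxi
        have hne : j ≠ i := hij.ne'
        have h1 : (x + unitVec i) j = x j := by simp [unitVec, hne]
        simp only [pureGauge, ψ, h1]
        rw [sub_eq_zero]
        refine Finset.sum_congr rfl fun m hm => ?_
        rw [Finset.mem_Ico] at hm
        set y := Function.update x j m with hy
        have hu : Function.update (x + unitVec i) j m = y + unitVec i := by
          ext l
          by_cases hl : l = j
          · subst hl; simp [hy, unitVec, hne]
          · simp [hy, hl]
        rw [hu]
        have hxj := mem_box.mp hx j
        have hval : ∀ l, l ≠ j → y l = x l := fun l hl => by simp [hy, hl]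
        have hvalj : y j = m := by simp [hy]
        have hbox : ∀ (s t : ℤ), (s = 0 ∨ s = 1) → (t = 0 ∨ t = 1) →
            y + s • unitVec i + t • unitVec j ∈ box d L := by
          intro s t hs ht
          rw [mem_box]
          intro l
          have b1 := mem_box.mp hx l
          have b2 := mem_box.mp hxi l
          by_cases hl : l = j
          · subst hl
            simp only [Pi.add_apply, Pi.smul_apply, hvalj, unitVec, Pi.single_eq_same,
              Pi.single_eq_of_ne hne, smul_eq_mul, mul_zero, mul_one, add_zero]
            rcases ht with rfl | rfl <;> omega
          · by_cases hli : l = i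
            · subst hli
              simp only [Pi.add_apply, unitVec, Pi.single_eq_same] at b2
              simp only [Pi.add_apply, Pi.smul_apply, hval l hl, unitVec, Pi.single_eq_same,
                Pi.single_eq_of_ne hl, smul_eq_mul, mul_zero, mul_one, add_zero]
              rcases hs with rfl | rfl <;> omega
            · simp only [Pi.add_apply, Pi.smul_apply, hval l hl, unitVec, Pi.single_eq_of_ne hl,
                Pi.single_eq_of_ne hli, smul_eq_mul, mul_zero, add_zero]
              exact b1
        have c00 : y ∈ box d L := by simpa using hbox 0 0 (Or.inl rfl) (Or.inl rfl)
        have c10 : y + unitVec i ∈ box d L := by simpa using hbox 1 0 (Or.inr rfl) (Or.inl rfl)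
        have c01 : y + unitVec j ∈ box d L := by simpa using hbox 0 1 (Or.inl rfl) (Or.inr rfl)
        have c11 : y + unitVec i + unitVec j ∈ box d L := by
          simpa using hbox 1 1 (Or.inr rfl) (Or.inr rfl)
        have hp := hBflux (y, i, j) (by simp [plaquettes, c00, c10, c01, c11, hij])
        have e1 := hB0 (y, i) (by simp [bonds, c00, c10]) hij
        have e2 := hB0 (y + unitVec j, i)
          (by rw [add_right_comm] at c11; simp [bonds, c01, c11]) hij
        rw [flux, e1, e2, zero_add, sub_zero] at hp
        exact sub_eq_zero.mp hp
      refine ⟨θ + ψ, fun b hb hbk => ?_⟩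
      have hAB : A b = pureGauge θ b + B b := by
        rw [hB, Pi.add_apply, hneg]; abel
      rw [pureGauge_add, Pi.add_apply, hAB]
      congr 1
      obtain ⟨x, i⟩ := b
      simp only [bonds, Finset.mem_filter, Finset.mem_product, Finset.mem_univ, and_true] at hb
      rcases Nat.lt_succ_iff_lt_or_eq.mp hbk with h | h
      · rw [hψi x i h hb.1 hb.2]
        exact hB0 (x, i) (by simp [bonds, hb]) h
      · have : i = j := Fin.ext h
        subst this
        exact (hψj x hb.1).symm
  obtain ⟨θ, hθ⟩ := key d
  exact ⟨θ, fun b hb => hθ b hb b.2.isLt⟩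

/-- A continuous function of the gauge field depends on finitely many bonds up to a small error. -/
theorem exists_finset_bonds_approx {f : GaugeField d → ℝ} (hf : Continuous f) {ε : ℝ}
    (hε : 0 < ε) :
    ∃ E : Finset (Bond d), ∀ A B : GaugeField d, (∀ b ∈ E, A b = B b) → |f A - f B| < ε := by
  have huc := CompactSpace.uniformContinuous_of_continuous hf
  have h1 : {p : GaugeField d × GaugeField d | dist (f p.1) (f p.2) < ε} ∈
      uniformity (GaugeField d) := huc (Metric.dist_mem_uniformity hε)
  rw [Pi.uniformity, Filter.mem_iInf] at h1
  obtain ⟨I, hI, V, hV, heq⟩ := h1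
  refine ⟨hI.toFinset, fun A B hAB => ?_⟩
  have : (A, B) ∈ {p : GaugeField d × GaugeField d | dist (f p.1) (f p.2) < ε} := by
    rw [heq]
    refine Set.mem_iInter.mpr fun i => ?_
    obtain ⟨W, hW, hWV⟩ := Filter.mem_comap.mp (hV i)
    refine hWV ?_
    change (A i, B i) ∈ W
    rw [hAB i (hI.mem_toFinset.mpr i.2)]
    exact refl_mem_uniformity hW
  exact this

theorem exists_subset_bonds_box (E : Finset (Bond d)) : ∃ L, E ⊆ bonds (box d L) := by
  have hmono : Monotone (box d) := by
    intro L L' h x hx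
    rw [mem_box] at hx ⊢
    exact fun i => ⟨by have := hx i; omega, by have := hx i; omega⟩
  have hexh : ∀ x : Site d, ∃ L, x ∈ box d L := by
    intro x
    refine ⟨∑ i, (x i).natAbs, mem_box.mpr fun i => ?_⟩
    have := Finset.single_le_sum (f := fun i => (x i).natAbs) (fun _ _ => Nat.zero_le _)
      (Finset.mem_univ i)
    omega
  obtain ⟨L, hL⟩ := (eventually_subset hmono hexh
    (E.image (fun b => b.1) ∪ E.image (fun b => b.1 + unitVec b.2))).exists
  refine ⟨L, fun b hb => ?_⟩
  have h1 := hL (Finset.mem_union_left _ (Finset.mem_image_of_mem _ hb))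
  have h2 := hL (Finset.mem_union_right _ (Finset.mem_image_of_mem _ hb))
  simp [bonds, h1, h2]

/-- The restriction to `Λ` of a pure gauge field. -/
noncomputable def localPureGauge (Λ : Finset (Site d)) (θ : Site d → Angle) : zeroFlux Λ :=
  ⟨fun b => pureGauge θ b.1, fun p hp => by
    rw [flux_congr (B := pureGauge θ) (fun b hb => by simp [extend, hb]) hp, flux_pureGauge]⟩

theorem continuous_localPureGauge (Λ : Finset (Site d)) : Continuous (localPureGauge Λ) :=
  Continuous.subtype_mk (f := fun θ (b : {b // b ∈ bonds Λ}) => pureGauge θ b.1)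
    (continuous_pi fun b => (continuous_apply b.1).comp continuous_pureGauge) _

/-- On a fixed finite set of bonds, the fields without flux on a large `Λ` are pure gauge fields,
and their distribution is invariant under gauge transformations. -/
theorem isZeroFluxLimit_zeroFluxMeasure {Λ : ℕ → Finset (Site d)} (hmono : Monotone Λ)
    (hexh : ∀ x, ∃ n, x ∈ Λ n) : IsZeroFluxLimit Λ (zeroFluxMeasure d) := by
  intro f hf
  refine ⟨_, fun n => tendsto_gaugeAverage (Λ n) hf, ?_⟩
  rw [zeroFluxMeasure, integral_map continuous_pureGauge.measurable.aemeasurable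
    hf.aestronglyMeasurable, Metric.tendsto_nhds]
  intro ε hε
  obtain ⟨E, hE⟩ := exists_finset_bonds_approx hf (half_pos hε)
  obtain ⟨L, hL⟩ := exists_subset_bonds_box E
  filter_upwards [eventually_subset hmono hexh (box d L)] with n hn
  set ν := haarProb (zeroFlux (Λ n))
  set c := ∫ θ, f (pureGauge θ) ∂(gaugeHaar d)
  have hjoint : Continuous fun p : (Site d → Angle) × zeroFlux (Λ n) =>
      f (extend (Λ n) ((p.2 + localPureGauge (Λ n) p.1 : zeroFlux (Λ n)) : LocalField (Λ n))) := by
    have := continuous_localPureGauge (Λ n)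
    exact hf.comp (continuous_extend.comp (continuous_subtype_val.comp
      (continuous_snd.add (this.comp continuous_fst))))
  have hswap : ∫ u : zeroFlux (Λ n), f (extend (Λ n) u) ∂ν =
      ∫ u : zeroFlux (Λ n), (∫ θ, f (extend (Λ n) ((u + localPureGauge (Λ n) θ :
        zeroFlux (Λ n)) : LocalField (Λ n))) ∂(gaugeHaar d)) ∂ν := by
    calc ∫ u : zeroFlux (Λ n), f (extend (Λ n) u) ∂ν
        = ∫ _θ, (∫ u : zeroFlux (Λ n), f (extend (Λ n) u) ∂ν) ∂(gaugeHaar d) := by simp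
      _ = ∫ θ, (∫ u : zeroFlux (Λ n), f (extend (Λ n) ((u + localPureGauge (Λ n) θ :
            zeroFlux (Λ n)) : LocalField (Λ n))) ∂ν) ∂(gaugeHaar d) := by
          refine integral_congr_ae (ae_of_all _ fun θ => ?_)
          exact (integral_add_right_eq_self
            (fun u : zeroFlux (Λ n) => f (extend (Λ n) u)) (localPureGauge (Λ n) θ)).symm
      _ = _ := by
          have : OpensMeasurableSpace ((Site d → Angle) × zeroFlux (Λ n)) :=
            Prod.opensMeasurableSpace
          exact integral_integral_swap (integrable_of_continuous_of_compactSpace hjoint)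
  have hbound : ∀ u : zeroFlux (Λ n), |(∫ θ, f (extend (Λ n) ((u + localPureGauge (Λ n) θ :
      zeroFlux (Λ n)) : LocalField (Λ n))) ∂(gaugeHaar d)) - c| ≤ ε / 2 := by
    intro u
    obtain ⟨θu, hθu⟩ := exists_pureGauge_eq_of_flux_eq_zero (A := extend (Λ n) u)
      (fun p hp => u.2 p (plaquettes_mono hn hp))
    have hshift : c = ∫ θ, f (pureGauge (θu + θ)) ∂(gaugeHaar d) :=
      (integral_add_left_eq_self (fun θ => f (pureGauge θ)) θu).symm
    have hc1 : Continuous fun θ : Site d → Angle => f (extend (Λ n)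
        ((u + localPureGauge (Λ n) θ : zeroFlux (Λ n)) : LocalField (Λ n))) :=
      hjoint.comp (continuous_id.prodMk continuous_const)
    have hc2 : Continuous fun θ : Site d → Angle => f (pureGauge (θu + θ)) :=
      hf.comp (continuous_pureGauge.comp (continuous_const.add continuous_id))
    rw [hshift, ← integral_sub (integrable_of_continuous_of_compactSpace hc1)
      (integrable_of_continuous_of_compactSpace hc2)]
    have := norm_integral_le_of_norm_le_const (μ := gaugeHaar d) (C := ε / 2)
      (f := fun θ => f (extend (Λ n) ((u + localPureGauge (Λ n) θ : zeroFlux (Λ n)) :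
        LocalField (Λ n))) - f (pureGauge (θu + θ))) (ae_of_all _ fun θ => by
        refine (hE _ _ fun b hb => ?_).le
        have hb1 := hL hb
        have hb2 := bonds_mono hn hb1
        rw [AddSubgroup.coe_add, extend_add, pureGauge_add, Pi.add_apply, Pi.add_apply, hθu b hb1]
        simp [extend, localPureGauge, hb2])
    simpa using this
  have hc3 : Continuous fun u : zeroFlux (Λ n) => ∫ θ, f (extend (Λ n)
      ((u + localPureGauge (Λ n) θ : zeroFlux (Λ n)) : LocalField (Λ n))) ∂(gaugeHaar d) := by
    have := continuous_parametric_integral_of_continuous (μ := gaugeHaar d) (s := Set.univ)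
      (f := fun (u : zeroFlux (Λ n)) (θ : Site d → Angle) => f (extend (Λ n)
        ((u + localPureGauge (Λ n) θ : zeroFlux (Λ n)) : LocalField (Λ n))))
      (hjoint.comp continuous_swap) isCompact_univ
    simpa using this
  have hfinal := norm_integral_le_of_norm_le_const (μ := ν) (C := ε / 2)
    (f := fun u => (∫ θ, f (extend (Λ n) ((u + localPureGauge (Λ n) θ : zeroFlux (Λ n)) :
      LocalField (Λ n))) ∂(gaugeHaar d)) - c) (ae_of_all _ hbound)
  rw [integral_sub (integrable_of_continuous_of_compactSpace hc3) (integrable_const c),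
    ← hswap] at hfinal
  simp only [integral_const, probReal_univ, smul_eq_mul, one_mul, mul_one] at hfinal
  rw [Real.dist_eq]
  exact lt_of_le_of_lt hfinal (half_lt_self hε)

theorem eq_of_isZeroFluxLimit {Λ : ℕ → Finset (Site d)} {P Q : Measure (GaugeField d)}
    [IsProbabilityMeasure P] [IsProbabilityMeasure Q] (hP : IsZeroFluxLimit Λ P)
    (hQ : IsZeroFluxLimit Λ Q) : P = Q := by
  refine ext_of_forall_integral_eq_of_IsFiniteMeasure fun f => ?_
  obtain ⟨g, hg, hgP⟩ := hP f f.continuous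
  obtain ⟨g', hg', hgQ⟩ := hQ f f.continuous
  have : g = g' := funext fun n => tendsto_nhds_unique (hg n) (hg' n)
  subst this
  exact tendsto_nhds_unique hgP hgQ

end InfiniteVolume

end QuenchedGauge

theorem mainTheorem3 (d : ℕ) (hd : 1 ≤ d) (model : QuenchedGauge.Model d)
    (Λ : ℕ → Finset (QuenchedGauge.Site d)) (hΛ_mono : Monotone Λ)
    (hΛ_exhaust : ∀ x : QuenchedGauge.Site d, ∃ n, x ∈ Λ n)
    (β : ℝ) (hβ : 0 < β) :
    (∃ P : Measure (QuenchedGauge.GaugeField d),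
      IsProbabilityMeasure P ∧ QuenchedGauge.IsZeroFluxLimit Λ P) ∧
    ∀ P : Measure (QuenchedGauge.GaugeField d),
      IsProbabilityMeasure P → QuenchedGauge.IsZeroFluxLimit Λ P →
        ∀ᵐ A ∂P, model.spontaneousMagnetization Λ β A = {0} ∧
          model.longRangeOrder Λ β A = {0} := by
  have hlim := QuenchedGauge.isZeroFluxLimit_zeroFluxMeasure hΛ_mono hΛ_exhaust
  refine ⟨⟨_, inferInstance, hlim⟩, fun P hP hPlim => ?_⟩
  rw [QuenchedGauge.eq_of_isZeroFluxLimit hPlim hlim]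
  exact model.ae_order_eq_zero hd hΛ_mono hΛ_exhaust hβ
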